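/- **Theorem.** Let $\mathbf{k}$ be a commutative $\mathbb{Q}$-algebra and $G$ a finite abelian group (written multiplicatively). *The group.* Let $\mathbf{k}\langle\langle X\rangle\rangle$ be the algebra of noncommutative formal power series in the letters $x_0$ and $x_g$ ($g\in G$), all of degree $1$; $(f|w)$ denotes the coefficient of the word $w$ in $f$. Let $\hat\Delta:\mathbf{k}\langle\langle X\rangle\rangle\to\mathbf{k}\langle\langle X\rangle\rangle^{\hat\otimes 2}$ be the continuous algebra morphism for which all letters are primitive, and let $\mathcal{G}$ be the set of invertible $\Psi\in\mathbf{k}\langle\langle X\rangle\rangle$ with $\hat\Delta(\Psi)=\Psi\otimes\Psi$. For $g\in G$ let $t_g$ be the continuous algebra automorphism $x_0\mapsto x_0$, $x_h\mapsto x_{gh}$. For $\Psi\in\mathcal{G}$ let $\mathrm{aut}_\Psi$ be the continuous algebra automorphism $x_0\mapsto x_0$, $x_g\mapsto t_g(\Psi^{-1})\,x_g\,t_g(\Psi)$. Then $\Psi\circledast\Phi:=\Psi\,\mathrm{aut}_\Psi(\Phi)$ makes $\mathcal{G}$ a group. Put $$\Gamma_\Psi(x):=\exp\Big(\sum_{n\ge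 2}\tfrac{(-1)^{n-1}}{n}\,(\Psi|x_0^{n-1}x_1)\,x^n\Big)\in\mathbf{k}[[x]]^\times ,$$ where $x_1$ is the letter $x_g$ with $g=1_G$. *The action on $\hat{\mathcal W}_G$.* Let $\hat{\mathcal V}_G$ be the complete graded $\mathbf{k}$-algebra generated by $e_0,e_1$ (degree $1$) and the elements $g\in G$ (degree $0$), with relations $g\times h=gh$, $1=1_G$, $g\times e_0=e_0\times g$. Let $\hat{\mathcal W}_G:=\mathbf{k}\oplus\hat{\mathcal V}_Ge_1$, a subalgebra. Let $\beta:\mathbf{k}\langle\langle X\rangle\rangle\to\hat{\mathcal V}_G$ be the continuous algebra morphism $x_0\mapsto e_0$, $x_g\mapsto -g e_1 g^{-1}$. For $\Psi\in\mathcal{G}$ let $\mathrm{aut}^{\mathcal V,(0)}_\Psi$ be the continuous algebra automorphism of $\hat{\mathcal V}_G$ given by $e_0\mapsto e_0$, $e_1\mapsto\beta(\Psi)^{-1}e_1\beta(\Psi)$, $g\mapsto g$, let $\mathrm{aut}^{\mathcal V,(1)}_\Psi:=\mathrm{Ad}_{\beta(\Psi)}\circ\mathrm{aut}^{\mathcal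 V,(0)}_\Psi$ and ${}^\Gamma\mathrm{aut}^{\mathcal V,(1)}_\Psi:=\mathrm{Ad}_{\Gamma_\Psi(-e_1)^{-1}}\circ\mathrm{aut}^{\mathcal V,(1)}_\Psi$, where $\mathrm{Ad}_u(a)=uau^{-1}$. The latter restricts to an automorphism ${}^\Gamma\mathrm{aut}^{\mathcal W,(1)}_\Psi$ of $\hat{\mathcal W}_G$, and $\Psi\mapsto{}^\Gamma\mathrm{aut}^{\mathcal W,(1)}_\Psi$ is an action of $(\mathcal{G},\circledast)$. *The action on $\mathbf{k}\langle\langle Y\rangle\rangle$.* Let $\mathbf{k}\langle\langle Y\rangle\rangle$ be the algebra of noncommutative formal power series in the letters $y_{n,g}$ ($n\ge 1$, $g\in G$; $y_{n,g}$ of degree $n$). Put $z_{n,g}:=-e_0^{n-1}ge_1\in\hat{\mathcal W}_G$. The continuous algebra morphism $\varpi:\mathbf{k}\langle\langle Y\rangle\rangle\to\hat{\mathcal W}_G$, $y_{n,g}\mapsto z_{n,g}$, is an isomorphism; put ${}^\Gamma\mathrm{aut}^Y_\Psi:=\varpi^{-1}\circ{}^\Gamma\mathrm{aut}^{\mathcal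 W,(1)}_\Psi\circ\varpi$. *The coproducts.* Let $\hat\Delta^{\mathrm{alg}}_\star:\mathbf{k}\langle\langle Y\rangle\rangle\to\mathbf{k}\langle\langle Y\rangle\rangle^{\hat\otimes 2}$ and $\hat\Delta^{\mathcal W}_G:\hat{\mathcal W}_G\to\hat{\mathcal W}_G^{\hat\otimes 2}$ be the continuous algebra morphisms with $$\hat\Delta^{\mathrm{alg}}_\star(y_{n,g})=y_{n,g}\otimes 1+1\otimes y_{n,g}+\sum_{k=1}^{n-1}\sum_{h\in G}y_{k,h}\otimes y_{n-k,gh^{-1}},$$ $$\hat\Delta^{\mathcal W}_G(z_{n,g})=z_{n,g}\otimes 1+1\otimes z_{n,g}+\sum_{k=1}^{n-1}\sum_{h\in G}z_{k,h}\otimes z_{n-k,gh^{-1}}.$$ *Conclusion.* Define the subgroups of $(\mathcal{G},\circledast)$ $$\mathsf{Stab}(\hat\Delta^{\mathrm{alg}}_\star)(\mathbf{k}):=\{\Psi\in\mathcal{G}\mid({}^\Gamma\mathrm{aut}^Y_\Psi)^{\otimes 2}\circ\hat\Delta^{\mathrm{alg}}_\star=\hat\Delta^{\mathrm{alg}}_\star\circ{}^\Gamma\mathrm{aut}^Y_\Psi\},$$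 $$\mathsf{Stab}(\hat\Delta^{\mathcal W}_G)(\mathbf{k}):=\{\Psi\in\mathcal{G}\mid({}^\Gamma\mathrm{aut}^{\mathcal W,(1)}_\Psi)^{\otimes 2}\circ\hat\Delta^{\mathcal W}_G=\hat\Delta^{\mathcal W}_G\circ{}^\Gamma\mathrm{aut}^{\mathcal W,(1)}_\Psi\}.$$ Then $\mathsf{Stab}(\hat\Delta^{\mathrm{alg}}_\star)(\mathbf{k})=\mathsf{Stab}(\hat\Delta^{\mathcal W}_G)(\mathbf{k})$ as subgroups of $(\mathcal{G},\circledast)$. -/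

import Mathlib

set_option linter.unusedSectionVars false

namespace DoubleShuffle

open scoped TensorProduct

/-- A monoid with an additive weight all of whose weight pieces are finite. -/
class WeightedMonoid (M : Type*) extends Monoid M where
  wt : M → ℕ
  wt_mul : ∀ a b : M, wt (a * b) = wt a + wt b
  finite_wt : ∀ n : ℕ, {m : M | wt m ≤ n}.Finite

namespace WeightedMonoid
variable {M : Type*} [WeightedMonoid M]

theorem wt_one : wt (1 : M) = 0 := by
  have := wt_mul (1 : M) 1
  rw [one_mul] at this; omega

/-- The finite set of elements of weight at most `n`. -/
noncomputable def ball (M : Type*) [WeightedMonoid M] (n : ℕ) : Finset M := (finite_wt n).toFinset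

theorem mem_ball {n : ℕ} {m : M} : m ∈ ball M n ↔ wt m ≤ n := by simp [ball]

end WeightedMonoid

open WeightedMonoid

/-- The complete graded algebra of formal series `∑ m, f m • m` over a weighted monoid `M`, that is
the degree completion of the monoid algebra `k[M]`; multiplication is convolution. -/
def Series (k M : Type*) : Type _ := M → k

namespace Series
variable {k : Type*} [CommRing k] {M : Type*}

noncomputable instance : AddCommGroup (Series k M) := inferInstanceAs (AddCommGroup (M → k))
noncomputable instance : Module k (Series k M) := inferInstanceAs (Module k (M → k))

/-- The coefficient `(f | m)`. -/
def coeff (f : Series k M) (m : M) : k := f m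

@[ext] theorem ext {f g : Series k M} (h : ∀ m, f.coeff m = g.coeff m) : f = g := funext h
@[simp] theorem coeff_add (f g : Series k M) (m : M) :
    (f + g).coeff m = f.coeff m + g.coeff m := rfl
@[simp] theorem coeff_sub (f g : Series k M) (m : M) :
    (f - g).coeff m = f.coeff m - g.coeff m := rfl
@[simp] theorem coeff_neg (f : Series k M) (m : M) : (-f).coeff m = -f.coeff m := rfl
@[simp] theorem coeff_smul (r : k) (f : Series k M) (m : M) :
    (r • f).coeff m = r * f.coeff m := rfl
@[simp] theorem coeff_zero (m : M) : (0 : Series k M).coeff m = 0 := rfl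
@[simp] theorem coeff_sum {ι : Type*} (s : Finset ι) (f : ι → Series k M) (m : M) :
    (∑ i ∈ s, f i).coeff m = ∑ i ∈ s, (f i).coeff m := by
  classical
  induction s using Finset.induction_on with
  | empty => simp
  | insert a s ha ih => simp [Finset.sum_insert ha, ih]

open Classical in
/-- The monomial `r • m`. -/
noncomputable def single (m : M) (r : k) : Series k M := fun p => if p = m then r else 0

open Classical in
theorem coeff_single (m : M) (r : k) (p : M) :
    (single m r).coeff p = if p = m then r else 0 := rfl

variable [WeightedMonoid M]

open Classical in
noncomputable instance : Mul (Series k M) where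
  mul f g := fun m =>
    ∑ a ∈ ball M (wt m), ∑ b ∈ ball M (wt m), if a * b = m then f.coeff a * g.coeff b else 0

noncomputable instance : One (Series k M) where
  one := single 1 1

theorem one_def : (1 : Series k M) = single 1 1 := rfl

open Classical in
theorem coeff_mul_def (f g : Series k M) (m : M) : (f * g).coeff m =
    ∑ a ∈ ball M (wt m), ∑ b ∈ ball M (wt m),
      if a * b = m then f.coeff a * g.coeff b else 0 := rfl

open Classical in
theorem coeff_mul (f g : Series k M) {m : M} {n : ℕ} (h : wt m ≤ n) : (f * g).coeff m =
    ∑ a ∈ ball M n, ∑ b ∈ ball M n, if a * b = m then f.coeff a * g.coeff b else 0 := by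
  rw [coeff_mul_def]
  have hs : ball M (wt m) ⊆ ball M n := fun a ha => mem_ball.2 ((mem_ball.1 ha).trans h)
  have : ∀ a b : M, a * b = m → a ∈ ball M (wt m) ∧ b ∈ ball M (wt m) := by
    rintro a b rfl
    rw [mem_ball, mem_ball, wt_mul]; omega
  rw [← Finset.sum_subset hs]
  · refine Finset.sum_congr rfl fun a _ => Finset.sum_subset hs fun b _ hb => ?_
    rw [if_neg fun h' => hb (this a b h').2]
  · intro a _ ha
    refine Finset.sum_eq_zero fun b _ => ?_
    rw [if_neg fun h' => ha (this a b h').1]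

open Classical in
theorem coeff_single_mul (a : M) (r : k) (g : Series k M) (m : M) {n : ℕ} (h : wt m ≤ n) :
    (single a r * g).coeff m = ∑ b ∈ ball M n, if a * b = m then r * g.coeff b else 0 := by
  rw [coeff_mul _ _ (h.trans (le_max_left n (wt a))),
    Finset.sum_eq_single_of_mem a (mem_ball.2 (le_max_right _ _))]
  · symm
    simp only [coeff_single, if_true]
    refine Finset.sum_subset (fun b hb => mem_ball.2 ((mem_ball.1 hb).trans (le_max_left _ _))) ?_
    intro b _ hb
    rw [if_neg]
    rintro rfl
    exact hb (mem_ball.2 (by rw [wt_mul] at h; omega))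
  · intro b _ hb
    simp [coeff_single, hb]

open Classical in
theorem coeff_mul_single (a : M) (r : k) (g : Series k M) (m : M) {n : ℕ} (h : wt m ≤ n) :
    (g * single a r).coeff m = ∑ b ∈ ball M n, if b * a = m then g.coeff b * r else 0 := by
  rw [coeff_mul _ _ (h.trans (le_max_left n (wt a))), Finset.sum_comm,
    Finset.sum_eq_single_of_mem a (mem_ball.2 (le_max_right _ _))]
  · symm
    simp only [coeff_single, if_true]
    refine Finset.sum_subset (fun b hb => mem_ball.2 ((mem_ball.1 hb).trans (le_max_left _ _))) ?_
    intro b _ hb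
    rw [if_neg]
    rintro rfl
    exact hb (mem_ball.2 (by rw [wt_mul] at h; omega))
  · intro b _ hb
    simp [coeff_single, hb]

protected theorem one_mul' (f : Series k M) : 1 * f = f := by
  classical
  ext m
  rw [one_def, coeff_single_mul 1 1 f m le_rfl]
  simp [mem_ball]

protected theorem mul_one' (f : Series k M) : f * 1 = f := by
  classical
  ext m
  rw [one_def, coeff_mul_single 1 1 f m le_rfl]
  simp [mem_ball]

protected theorem mul_assoc' (f g h : Series k M) : f * g * h = f * (g * h) := by
  classical
  ext m
  rw [coeff_mul _ _ le_rfl, coeff_mul _ _ le_rfl]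
  have key : ∀ a b c : M, a * b * c = m → a * b ∈ ball M (wt m) ∧ b * c ∈ ball M (wt m) := by
    rintro a b c rfl
    simp only [mem_ball, wt_mul]; omega
  trans ∑ a ∈ ball M (wt m), ∑ b ∈ ball M (wt m), ∑ c ∈ ball M (wt m),
    if a * b * c = m then f.coeff a * g.coeff b * h.coeff c else 0
  · rw [Finset.sum_comm]
    trans ∑ c ∈ ball M (wt m), ∑ a ∈ ball M (wt m), ∑ b ∈ ball M (wt m),
      if a * b * c = m then f.coeff a * g.coeff b * h.coeff c else 0
    · refine Finset.sum_congr rfl fun c _ => ?_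
      trans ∑ p ∈ ball M (wt m), ∑ a ∈ ball M (wt m), ∑ b ∈ ball M (wt m),
        if a * b = p then (if a * b * c = m then f.coeff a * g.coeff b * h.coeff c else 0) else 0
      · refine Finset.sum_congr rfl fun p hp => ?_
        rw [coeff_mul f g (mem_ball.1 hp), Finset.sum_mul]
        by_cases hpm : p * c = m
        · rw [if_pos hpm]
          refine Finset.sum_congr rfl fun a _ => ?_
          rw [Finset.sum_mul]
          refine Finset.sum_congr rfl fun b _ => ?_
          by_cases hab : a * b = p
          · simp [hab, hpm]
          · simp [hab]
        · rw [if_neg hpm]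
          symm
          refine Finset.sum_eq_zero fun a _ => Finset.sum_eq_zero fun b _ => ?_
          by_cases hab : a * b = p
          · simp [hab, hpm]
          · simp [hab]
      · rw [Finset.sum_comm]
        refine Finset.sum_congr rfl fun a _ => ?_
        rw [Finset.sum_comm]
        refine Finset.sum_congr rfl fun b _ => ?_
        rw [Finset.sum_ite_eq]
        by_cases hm : a * b * c = m
        · simp [hm, (key a b c hm).1]
        · simp [hm]
    · rw [Finset.sum_comm]
      refine Finset.sum_congr rfl fun a _ => ?_
      rw [Finset.sum_comm]
  · refine Finset.sum_congr rfl fun a _ => ?_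
    symm
    trans ∑ p ∈ ball M (wt m), ∑ b ∈ ball M (wt m), ∑ c ∈ ball M (wt m),
        if b * c = p then (if a * b * c = m then f.coeff a * g.coeff b * h.coeff c else 0) else 0
    · refine Finset.sum_congr rfl fun p hp => ?_
      rw [coeff_mul g h (mem_ball.1 hp), Finset.mul_sum]
      by_cases hpm : a * p = m
      · rw [if_pos hpm]
        refine Finset.sum_congr rfl fun b _ => ?_
        rw [Finset.mul_sum]
        refine Finset.sum_congr rfl fun c _ => ?_
        by_cases hab : b * c = p
        · simp [hab, hpm, mul_assoc]
        · simp [hab]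
      · rw [if_neg hpm]
        symm
        refine Finset.sum_eq_zero fun b _ => Finset.sum_eq_zero fun c _ => ?_
        by_cases hab : b * c = p
        · simp [hab, hpm, mul_assoc]
        · simp [hab]
    · rw [Finset.sum_comm]
      refine Finset.sum_congr rfl fun b _ => ?_
      rw [Finset.sum_comm]
      refine Finset.sum_congr rfl fun c _ => ?_
      rw [Finset.sum_ite_eq]
      by_cases hm : a * b * c = m
      · simp [hm, (key a b c hm).2]
      · simp [hm]

theorem mul_add' (f g h : Series k M) : f * (g + h) = f * g + f * h := by
  classical
  ext m
  simp only [coeff_add, coeff_mul_def, ← Finset.sum_add_distrib]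
  refine Finset.sum_congr rfl fun a _ => Finset.sum_congr rfl fun b _ => ?_
  split_ifs <;> ring

theorem add_mul' (f g h : Series k M) : (f + g) * h = f * h + g * h := by
  classical
  ext m
  simp only [coeff_add, coeff_mul_def, ← Finset.sum_add_distrib]
  refine Finset.sum_congr rfl fun a _ => Finset.sum_congr rfl fun b _ => ?_
  split_ifs <;> ring

noncomputable instance : Ring (Series k M) :=
  { (inferInstance : AddCommGroup (Series k M)), (inferInstance : Mul (Series k M)),
    (inferInstance : One (Series k M)) with
    mul_assoc := Series.mul_assoc'
    one_mul := Series.one_mul'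
    mul_one := Series.mul_one'
    left_distrib := mul_add'
    right_distrib := add_mul'
    zero_mul := fun f => by ext m; simp [coeff_mul_def]
    mul_zero := fun f => by ext m; simp [coeff_mul_def] }

noncomputable instance : Algebra k (Series k M) :=
  Algebra.ofModule
    (fun r f g => by
      classical
      ext m
      simp only [coeff_smul, coeff_mul_def, Finset.mul_sum]
      refine Finset.sum_congr rfl fun a _ => Finset.sum_congr rfl fun b _ => ?_
      split_ifs <;> ring)
    (fun r f g => by
      classical
      ext m
      simp only [coeff_smul, coeff_mul_def, Finset.mul_sum]
      refine Finset.sum_congr rfl fun a _ => Finset.sum_congr rfl fun b _ => ?_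
      split_ifs <;> ring)

theorem single_mul_single (a b : M) (r s : k) :
    single a r * single b s = single (a * b) (r * s) := by
  classical
  ext m
  rw [coeff_single_mul a r _ m (le_max_left (wt m) (wt b)),
    Finset.sum_eq_single_of_mem b (mem_ball.2 (le_max_right _ _))]
  · simp [coeff_single, eq_comm]
  · intro c _ hc
    simp [coeff_single, hc]

/-- The inclusion of the monoid of monomials. -/
noncomputable def ofM (k : Type*) [CommRing k] (M : Type*) [WeightedMonoid M] :
    M →* Series k M where
  toFun m := single m 1
  map_one' := rfl
  map_mul' a b := by rw [single_mul_single, one_mul]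

theorem coeff_ofM (a m : M) [Decidable (m = a)] :
    (ofM k M a).coeff m = if m = a then 1 else 0 := by
  classical
  change (single a 1 : Series k M).coeff m = _
  rw [coeff_single]; congr

/-- The degree filtration: series all of whose terms have weight at least `n`. -/
def F (k : Type*) [CommRing k] (M : Type*) [WeightedMonoid M] (n : ℕ) : Ideal (Series k M) where
  carrier := {f | ∀ m, wt m < n → f.coeff m = 0}
  add_mem' := fun ha hb m hm => by simp [ha m hm, hb m hm]
  zero_mem' := fun m _ => rfl
  smul_mem' := fun c f hf m hm => by
    classical
    rw [smul_eq_mul, coeff_mul_def]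
    refine Finset.sum_eq_zero fun a _ => Finset.sum_eq_zero fun b _ => ?_
    split_ifs with h
    · rw [hf b (by rw [← h, wt_mul] at hm; omega), mul_zero]
    · rfl

theorem mem_F {n : ℕ} {f : Series k M} : f ∈ F k M n ↔ ∀ m, wt m < n → f.coeff m = 0 := Iff.rfl

instance (n : ℕ) : (F k M n).IsTwoSided where
  mul_mem_of_left := by
    intro f g hf m hm
    classical
    rw [coeff_mul_def]
    refine Finset.sum_eq_zero fun a _ => Finset.sum_eq_zero fun b _ => ?_
    split_ifs with h
    · rw [hf a (by rw [← h, wt_mul] at hm; omega), zero_mul]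
    · rfl

theorem F_mul {i j : ℕ} {f g : Series k M} (hf : f ∈ F k M i) (hg : g ∈ F k M j) :
    f * g ∈ F k M (i + j) := by
  classical
  intro m hm
  rw [coeff_mul_def]
  refine Finset.sum_eq_zero fun a _ => Finset.sum_eq_zero fun b _ => ?_
  split_ifs with h
  · rw [← h, wt_mul] at hm
    rcases lt_or_ge (wt a) i with h1 | h1
    · rw [hf a h1, zero_mul]
    · rw [hg b (by omega), mul_zero]
  · rfl

end Series

open WeightedMonoid

/-- A `k`-algebra with a decreasing multiplicative filtration by two-sided ideals. -/
class FilteredAlgebra (k A : Type*) [CommRing k] [Ring A] [Algebra k A] where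
  fil : ℕ → Ideal A
  fil_zero : fil 0 = ⊤
  twoSided : ∀ n, (fil n).IsTwoSided
  anti : Antitone fil
  fil_mul : ∀ {i j : ℕ} {a b : A}, a ∈ fil i → b ∈ fil j → a * b ∈ fil (i + j)

namespace FilteredAlgebra

variable (k : Type*) [CommRing k]
variable {A B C : Type*} [Ring A] [Algebra k A] [FilteredAlgebra k A]
  [Ring B] [Algebra k B] [FilteredAlgebra k B] [Ring C] [Algebra k C] [FilteredAlgebra k C]

instance (n : ℕ) : (fil k n : Ideal A).IsTwoSided := twoSided n

variable (A) in
/-- The quotient `A / Fⁿ A`. -/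
abbrev Quo (n : ℕ) : Type _ := A ⧸ (fil k n : Ideal A)

variable (A) in
/-- The projection `A → A / Fⁿ A`. -/
abbrev toQuo (n : ℕ) : A →ₐ[k] Quo k A n := Ideal.Quotient.mkₐ k (fil k n)

variable (A) in
/-- The transition map `(A / Fⁿ⁺¹ A)^{⊗ 2} → (A / Fⁿ A)^{⊗ 2}`. -/
noncomputable def trans (n : ℕ) :
    Quo k A (n + 1) ⊗[k] Quo k A (n + 1) →ₐ[k] Quo k A n ⊗[k] Quo k A n :=
  Algebra.TensorProduct.map (Ideal.Quotient.factorₐ k (anti n.le_succ))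
    (Ideal.Quotient.factorₐ k (anti n.le_succ))

variable (A) in
/-- The completed tensor square `A ⊗̂ A = lim_n (A / Fⁿ A) ⊗ (A / Fⁿ A)`, as a subalgebra of the
product. -/
noncomputable def TensorSq : Subalgebra k (∀ n : ℕ, Quo k A n ⊗[k] Quo k A n) where
  carrier := {t | ∀ n, trans k A n (t (n + 1)) = t n}
  mul_mem' ha hb n := by simp only [Pi.mul_apply, map_mul, ha n, hb n]
  add_mem' ha hb n := by simp only [Pi.add_apply, map_add, ha n, hb n]
  algebraMap_mem' r n := by simp only [Pi.algebraMap_apply, AlgHom.commutes]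

noncomputable instance : Ring (TensorSq k A) := Subalgebra.toRing _
noncomputable instance : Semiring (TensorSq k A) := Subalgebra.toSemiring _
noncomputable instance : Algebra k (TensorSq k A) := Subalgebra.algebra _

theorem trans_tmul (n : ℕ) (a b : A) :
    trans k A n (toQuo k A (n + 1) a ⊗ₜ toQuo k A (n + 1) b) =
      toQuo k A n a ⊗ₜ toQuo k A n b := by
  simp [trans]

/-- The element `a ⊗ b` of `A ⊗̂ A`. -/
noncomputable def tmul (a b : A) : TensorSq k A :=
  ⟨fun n => toQuo k A n a ⊗ₜ toQuo k A n b, fun n => trans_tmul k n a b⟩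

theorem tmul_apply (a b : A) (n : ℕ) :
    (tmul k a b).1 n = toQuo k A n a ⊗ₜ toQuo k A n b := rfl

theorem tmul_mul_tmul (a b c d : A) : tmul k a b * tmul k c d = tmul k (a * c) (b * d) := by
  ext n
  simp [tmul]

theorem tmul_one_one : tmul k (1 : A) 1 = 1 := by
  ext n
  simp [tmul, Algebra.TensorProduct.one_def]

/-- A `k`-algebra morphism compatible with the filtrations. -/
def IsFiltered (f : A →ₐ[k] B) : Prop := ∀ n a, a ∈ (fil k n : Ideal A) → f a ∈ (fil k n : Ideal B)

variable {k}

theorem IsFiltered.comp {f : B →ₐ[k] C} {g : A →ₐ[k] B} (hf : IsFiltered k f)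
    (hg : IsFiltered k g) : IsFiltered k (f.comp g) := fun n a ha => hf n _ (hg n a ha)

theorem IsFiltered.id : IsFiltered k (AlgHom.id k A) := fun _ _ ha => ha

/-- The morphism `A / Fⁿ A → B / Fⁿ B` induced by a filtered morphism. -/
noncomputable def quoMap (f : A →ₐ[k] B) (hf : IsFiltered k f) (n : ℕ) :
    Quo k A n →ₐ[k] Quo k B n :=
  Ideal.Quotient.liftₐ _ ((toQuo k B n).comp f) fun a ha => by
    simpa [Ideal.Quotient.eq_zero_iff_mem] using hf n a ha

theorem quoMap_mk (f : A →ₐ[k] B) (hf : IsFiltered k f) (n : ℕ) (a : A) :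
    quoMap f hf n (toQuo k A n a) = toQuo k B n (f a) := rfl

theorem quoMap_comp (f : B →ₐ[k] C) (hf : IsFiltered k f) (g : A →ₐ[k] B)
    (hg : IsFiltered k g) (n : ℕ) :
    (quoMap f hf n).comp (quoMap g hg n) = quoMap (f.comp g) (hf.comp hg) n :=
  Ideal.Quotient.algHom_ext _ rfl

theorem quoMap_id (n : ℕ) : quoMap (AlgHom.id k A) IsFiltered.id n = AlgHom.id k _ :=
  Ideal.Quotient.algHom_ext _ rfl

theorem trans_map (f : A →ₐ[k] B) (hf : IsFiltered k f) (n : ℕ) :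
    (trans k B n).comp (Algebra.TensorProduct.map (quoMap f hf (n + 1)) (quoMap f hf (n + 1))) =
      (Algebra.TensorProduct.map (quoMap f hf n) (quoMap f hf n)).comp (trans k A n) := by
  have h : (Ideal.Quotient.factorₐ k (anti n.le_succ)).comp (quoMap f hf (n + 1)) =
      (quoMap f hf n).comp (Ideal.Quotient.factorₐ k (anti n.le_succ)) :=
    Ideal.Quotient.algHom_ext _ rfl
  rw [trans, trans, ← Algebra.TensorProduct.map_comp, ← Algebra.TensorProduct.map_comp, h]

/-- The completed tensor square `f ⊗̂ f` of a filtered morphism. -/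
noncomputable def mapSq (f : A →ₐ[k] B) (hf : IsFiltered k f) : TensorSq k A →ₐ[k] TensorSq k B :=
  AlgHom.codRestrict
    ((AlgHom.pi fun n =>
      (Algebra.TensorProduct.map (quoMap f hf n) (quoMap f hf n)).comp
        (Pi.evalAlgHom k (fun n => Quo k A n ⊗[k] Quo k A n) n)).comp (TensorSq k A).val)
    (TensorSq k B) fun t n => by
      have := DFunLike.congr_fun (trans_map f hf n) (t.1 (n + 1))
      simp only [AlgHom.comp_apply] at this
      change trans k B n (Algebra.TensorProduct.map _ _ (t.1 (n + 1))) =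
        Algebra.TensorProduct.map _ _ (t.1 n)
      rw [this, t.2 n]

theorem mapSq_apply (f : A →ₐ[k] B) (hf : IsFiltered k f) (t : TensorSq k A) (n : ℕ) :
    (mapSq f hf t).1 n = Algebra.TensorProduct.map (quoMap f hf n) (quoMap f hf n) (t.1 n) := rfl

theorem mapSq_tmul (f : A →ₐ[k] B) (hf : IsFiltered k f) (a b : A) :
    mapSq f hf (tmul k a b) = tmul k (f a) (f b) := rfl

theorem mapSq_comp (f : B →ₐ[k] C) (hf : IsFiltered k f) (g : A →ₐ[k] B)
    (hg : IsFiltered k g) :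
    mapSq (f.comp g) (hf.comp hg) = (mapSq f hf).comp (mapSq g hg) := by
  ext t n
  rw [AlgHom.comp_apply, mapSq_apply, mapSq_apply, mapSq_apply, ← quoMap_comp f hf g hg,
    Algebra.TensorProduct.map_comp, AlgHom.comp_apply]

theorem mapSq_id : mapSq (AlgHom.id k A) IsFiltered.id = AlgHom.id k _ := by
  ext t n
  rw [mapSq_apply, quoMap_id, Algebra.TensorProduct.map_id]
  rfl

/-- The image of `∑_{i + j = N} Fⁱ ⊗ Fʲ` in `(A / Fⁿ A)^{⊗ 2}`. -/
noncomputable def sqFil (k A : Type*) [CommRing k] [Ring A] [Algebra k A] [FilteredAlgebra k A]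
    (n N : ℕ) : Submodule k (Quo k A n ⊗[k] Quo k A n) :=
  Submodule.span k {t | ∃ i j, ∃ a ∈ (fil k i : Ideal A), ∃ b ∈ (fil k j : Ideal A),
    N ≤ i + j ∧ t = toQuo k A n a ⊗ₜ toQuo k A n b}

theorem sqFil_eq_zero {n N : ℕ} (h : 2 * n ≤ N) {t : Quo k A n ⊗[k] Quo k A n}
    (ht : t ∈ sqFil k A n N) : t = 0 := by
  induction ht using Submodule.span_induction with
  | mem t ht =>
    obtain ⟨i, j, a, ha, b, hb, hN, rfl⟩ := ht
    rcases le_or_gt n i with h1 | h1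
    · have : toQuo k A n a = 0 := Ideal.Quotient.eq_zero_iff_mem.2 (anti h1 ha)
      rw [this, TensorProduct.zero_tmul]
    · have : toQuo k A n b = 0 :=
        Ideal.Quotient.eq_zero_iff_mem.2 (anti (show n ≤ j by omega) hb)
      rw [this, TensorProduct.tmul_zero]
  | zero => rfl
  | add x y _ _ hx hy => rw [hx, hy, add_zero]
  | smul r x _ hx => rw [hx, smul_zero]

theorem sqFil_mul {n N N' : ℕ} {s t : Quo k A n ⊗[k] Quo k A n}
    (hs : s ∈ sqFil k A n N) (ht : t ∈ sqFil k A n N') : s * t ∈ sqFil k A n (N + N') := by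
  induction hs using Submodule.span_induction with
  | mem s hs =>
    induction ht using Submodule.span_induction with
    | mem t ht =>
      obtain ⟨i, j, a, ha, b, hb, hN, rfl⟩ := hs
      obtain ⟨i', j', a', ha', b', hb', hN', rfl⟩ := ht
      rw [Algebra.TensorProduct.tmul_mul_tmul, ← map_mul, ← map_mul]
      exact Submodule.subset_span ⟨i + i', j + j', _, fil_mul ha ha', _, fil_mul hb hb',
        by omega, rfl⟩
    | zero => rw [mul_zero]; exact zero_mem _
    | add x y _ _ hx hy => rw [mul_add]; exact add_mem hx hy
    | smul r x _ hx => rw [mul_smul_comm]; exact Submodule.smul_mem _ _ hx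
  | zero => rw [zero_mul]; exact zero_mem _
  | add x y _ _ hx hy => rw [add_mul]; exact add_mem hx hy
  | smul r x _ hx => rw [smul_mul_assoc]; exact Submodule.smul_mem _ _ hx

theorem sqFil_anti {n N N' : ℕ} (h : N ≤ N') {t : Quo k A n ⊗[k] Quo k A n}
    (ht : t ∈ sqFil k A n N') : t ∈ sqFil k A n N := by
  refine Submodule.span_mono ?_ ht
  rintro t ⟨i, j, a, ha, b, hb, hN, rfl⟩
  exact ⟨i, j, a, ha, b, hb, h.trans hN, rfl⟩

theorem tmul_mem_sqFil {i j n N : ℕ} {a b : A} (ha : a ∈ (fil k i : Ideal A))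
    (hb : b ∈ (fil k j : Ideal A)) (h : N ≤ i + j) : (tmul k a b).1 n ∈ sqFil k A n N :=
  Submodule.subset_span ⟨i, j, a, ha, b, hb, h, rfl⟩

theorem one_mem_sqFil (n : ℕ) : (1 : Quo k A n ⊗[k] Quo k A n) ∈ sqFil k A n 0 :=
  Submodule.subset_span ⟨0, 0, 1, by rw [fil_zero]; trivial, 1, by rw [fil_zero]; trivial, by omega,
    by rw [map_one, Algebra.TensorProduct.one_def]⟩

/-- A subalgebra with the induced filtration. -/
instance instSubalgebra (S : Subalgebra k A) : FilteredAlgebra k S where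
  fil n := (fil k n : Ideal A).comap S.val
  fil_zero := by rw [fil_zero]; rfl
  twoSided n := ⟨fun b ha => Ideal.mul_mem_right (I := (fil k n : Ideal A)) _ ha⟩
  anti _ _ h _ ha := anti h ha
  fil_mul ha hb := fil_mul (k := k) (A := A) ha hb

theorem mem_fil_sub {S : Subalgebra k A} {n : ℕ} {a : S} :
    a ∈ (fil k n : Ideal S) ↔ (a : A) ∈ (fil k n : Ideal A) := Iff.rfl

variable (k) in
/-- Conjugation `Ad_u : a ↦ u a u⁻¹`. -/
def Ad (u : Aˣ) : A →ₐ[k] A where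
  toFun a := u * a * (u⁻¹ : Aˣ)
  map_one' := by simp
  map_mul' a b := by simp [mul_assoc]
  map_zero' := by simp
  map_add' a b := by simp [mul_add, add_mul]
  commutes' r := by rw [← Algebra.commutes, mul_assoc, Units.mul_inv, mul_one]

theorem Ad_apply (u : Aˣ) (a : A) : Ad k u a = u * a * (u⁻¹ : Aˣ) := rfl

theorem Ad_mul (u v : Aˣ) : Ad k (u * v) = (Ad k u).comp (Ad k v) := by
  ext a; simp [Ad_apply, mul_assoc]

theorem comp_Ad (f : A →ₐ[k] B) (u : Aˣ) :
    f.comp (Ad k u) = (Ad k (Units.map (f : A →* B) u)).comp f := by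
  ext a
  simp [Ad_apply, ← map_inv]

theorem isFiltered_Ad (u : Aˣ) : IsFiltered k (Ad k u) := fun _ _ ha =>
  Ideal.mul_mem_right _ _ (Ideal.mul_mem_left _ _ ha)

variable (k A) in
/-- The monoid of filtered algebra endomorphisms of `A`; its units are the filtered algebra
automorphisms. -/
def FEnd : Submonoid (A →ₐ[k] A) where
  carrier := {f | IsFiltered k f}
  mul_mem' hf hg := IsFiltered.comp hf hg
  one_mem' := IsFiltered.id

theorem FEnd.isFiltered (f : FEnd k A) : IsFiltered k (f : A →ₐ[k] A) := f.2

/-- The action `f ⊗̂ f` of a filtered endomorphism `f` of `A` on `A ⊗̂ A`. -/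
noncomputable def tensorSqMap (f : FEnd k A) : TensorSq k A →ₐ[k] TensorSq k A :=
  mapSq (f : A →ₐ[k] A) (FEnd.isFiltered f)

theorem tensorSqMap_mul (f g : FEnd k A) : tensorSqMap (f * g) = (tensorSqMap f).comp (tensorSqMap g) :=
  mapSq_comp _ (FEnd.isFiltered f) _ (FEnd.isFiltered g)

theorem tensorSqMap_one : tensorSqMap (1 : FEnd k A) = AlgHom.id k (TensorSq k A) := mapSq_id

theorem FEnd.comp_inv {H : Type*} [Group H] (ρ : H →* FEnd k A) (h : H) :
    (ρ h : A →ₐ[k] A).comp (ρ h⁻¹ : A →ₐ[k] A) = AlgHom.id k A := by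
  have : ρ h * ρ h⁻¹ = 1 := by rw [← map_mul, mul_inv_cancel, map_one]
  exact congrArg Subtype.val this

/-- The stabilizer of `D : A → A ⊗̂ A` under the action `h • D = ρ(h)^{⊗ 2} ∘ D ∘ ρ(h)⁻¹` of a
group `H` acting on `A` through `ρ`. -/
noncomputable def stab {H : Type*} [Group H] (ρ : H →* FEnd k A) (D : A →ₐ[k] TensorSq k A) :
    Subgroup H where
  carrier := {h | (tensorSqMap (ρ h)).comp D = D.comp (ρ h : A →ₐ[k] A)}
  one_mem' := by
    change (tensorSqMap (ρ 1)).comp D = D.comp (ρ 1 : A →ₐ[k] A)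
    rw [map_one, tensorSqMap_one]
    rfl
  mul_mem' {a b} ha hb := by
    change (tensorSqMap (ρ a)).comp D = D.comp (ρ a : A →ₐ[k] A) at ha
    change (tensorSqMap (ρ b)).comp D = D.comp (ρ b : A →ₐ[k] A) at hb
    change (tensorSqMap (ρ (a * b))).comp D = D.comp (ρ (a * b) : A →ₐ[k] A)
    rw [map_mul, tensorSqMap_mul, AlgHom.comp_assoc, hb, ← AlgHom.comp_assoc, ha, AlgHom.comp_assoc]
    rfl
  inv_mem' {a} ha := by
    change (tensorSqMap (ρ a)).comp D = D.comp (ρ a : A →ₐ[k] A) at ha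
    change (tensorSqMap (ρ a⁻¹)).comp D = D.comp (ρ a⁻¹ : A →ₐ[k] A)
    have h3 : (tensorSqMap (ρ a⁻¹)).comp (tensorSqMap (ρ a)) = AlgHom.id k (TensorSq k A) := by
      rw [← tensorSqMap_mul, ← map_mul, inv_mul_cancel, map_one, tensorSqMap_one]
    calc (tensorSqMap (ρ a⁻¹)).comp D
        = (tensorSqMap (ρ a⁻¹)).comp ((D.comp (ρ a : A →ₐ[k] A)).comp (ρ a⁻¹ : A →ₐ[k] A)) := by
          rw [AlgHom.comp_assoc, FEnd.comp_inv, AlgHom.comp_id]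
      _ = D.comp (ρ a⁻¹ : A →ₐ[k] A) := by
          rw [← ha, AlgHom.comp_assoc, ← AlgHom.comp_assoc, h3, AlgHom.id_comp]

theorem mem_stab {H : Type*} [Group H] (ρ : H →* FEnd k A) (D : A →ₐ[k] TensorSq k A) (h : H) :
    h ∈ stab ρ D ↔ (tensorSqMap (ρ h)).comp D = D.comp (ρ h : A →ₐ[k] A) := Iff.rfl

end FilteredAlgebra

namespace Series
open FilteredAlgebra
variable {k : Type*} [CommRing k] {M N : Type*} [WeightedMonoid M] [WeightedMonoid N]

instance : FilteredAlgebra k (Series k M) where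
  fil := F k M
  fil_zero := (Ideal.eq_top_iff_one _).2 fun _ hm => absurd hm (Nat.not_lt_zero _)
  twoSided := inferInstance
  anti := fun _ _ h _ hf m hm => hf m (hm.trans_le h)
  fil_mul := F_mul

theorem mem_fil {n : ℕ} {f : Series k M} :
    f ∈ (fil k n : Ideal (Series k M)) ↔ ∀ m, wt m < n → f.coeff m = 0 := Iff.rfl

theorem single_mem_fil (m : M) (r : k) : single m r ∈ (fil k (wt m) : Ideal (Series k M)) := by
  classical
  intro p hp
  rw [coeff_single, if_neg]
  rintro rfl
  exact lt_irrefl _ hp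

theorem ofM_mem_fil (m : M) : ofM k M m ∈ (fil k (wt m) : Ideal (Series k M)) :=
  single_mem_fil m 1

/-- The terms of weight at most `n`. -/
theorem sub_sum_mem (f : Series k M) (n : ℕ) :
    f - ∑ m ∈ ball M n, f.coeff m • ofM k M m ∈ (fil k (n + 1) : Ideal (Series k M)) := by
  classical
  intro p hp
  simp only [coeff_sub, coeff_sum, coeff_smul, coeff_ofM, mul_ite, mul_one, mul_zero]
  rw [Finset.sum_ite_eq, if_pos (mem_ball.2 (by omega)), sub_self]

/-- Two continuous linear maps to a discrete module that agree on monomials are equal. -/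
theorem linearMap_ext {V : Type*} [AddCommGroup V] [Module k V] {f g : Series k M →ₗ[k] V} (n : ℕ)
    (hf : ∀ a ∈ (fil k n : Ideal (Series k M)), f a = 0)
    (hg : ∀ a ∈ (fil k n : Ideal (Series k M)), g a = 0)
    (h : ∀ m, f (ofM k M m) = g (ofM k M m)) : f = g := by
  ext a
  have ha : a - ∑ m ∈ ball M n, a.coeff m • ofM k M m ∈ (fil k n : Ideal (Series k M)) :=
    anti (k := k) (Nat.le_succ n) (sub_sum_mem a n)
  have h1 := hf _ ha
  have h2 := hg _ ha
  rw [map_sub, sub_eq_zero] at h1 h2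
  rw [h1, h2]
  simp [h]

/-- The continuous algebra morphism to a discrete algebra defined by a morphism of monoids
that vanishes in large weight: `f ↦ ∑ m, (f | m) φ m`. -/
noncomputable def liftDiscrete {B : Type*} [Ring B] [Algebra k B] (φ : M →* B) (n : ℕ)
    (h : ∀ m, n ≤ wt m → φ m = 0) : Series k M →ₐ[k] B :=
  AlgHom.ofLinearMap
    { toFun := fun f => ∑ m ∈ ball M n, f.coeff m • φ m
      map_add' := fun f g => by simp [add_smul, Finset.sum_add_distrib]
      map_smul' := fun r f => by simp [mul_smul, Finset.smul_sum] }
    (by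
      classical
      change ∑ m ∈ ball M n, (1 : Series k M).coeff m • φ m = 1
      rw [Finset.sum_eq_single_of_mem 1 (mem_ball.2 (by rw [wt_one]; omega))]
      · simp [one_def, coeff_single]
      · intro b _ hb
        simp [one_def, coeff_single, hb])
    (by
      classical
      intro f g
      change ∑ m ∈ ball M n, (f * g).coeff m • φ m =
        (∑ m ∈ ball M n, f.coeff m • φ m) * (∑ m ∈ ball M n, g.coeff m • φ m)
      rw [Finset.sum_mul_sum]
      trans ∑ m ∈ ball M n, ∑ a ∈ ball M n, ∑ b ∈ ball M n,
        if a * b = m then (f.coeff a * g.coeff b) • (φ a * φ b) else 0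
      · refine Finset.sum_congr rfl fun m hm => ?_
        rw [coeff_mul f g (mem_ball.1 hm), Finset.sum_smul]
        refine Finset.sum_congr rfl fun a _ => ?_
        rw [Finset.sum_smul]
        refine Finset.sum_congr rfl fun b _ => ?_
        split_ifs with hab
        · rw [← hab, map_mul]
        · rw [zero_smul]
      · rw [Finset.sum_comm]
        refine Finset.sum_congr rfl fun a _ => ?_
        rw [Finset.sum_comm]
        refine Finset.sum_congr rfl fun b _ => ?_
        rw [Finset.sum_ite_eq]
        split_ifs with hab
        · rw [smul_mul_smul_comm]
        · rw [smul_mul_smul_comm, ← map_mul, h, smul_zero]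
          rw [mem_ball] at hab; omega)

theorem liftDiscrete_apply {B : Type*} [Ring B] [Algebra k B] (φ : M →* B) (n : ℕ)
    (h : ∀ m, n ≤ wt m → φ m = 0) (f : Series k M) :
    liftDiscrete φ n h f = ∑ m ∈ ball M n, f.coeff m • φ m := rfl

theorem liftDiscrete_ofM {B : Type*} [Ring B] [Algebra k B] (φ : M →* B) (n : ℕ)
    (h : ∀ m, n ≤ wt m → φ m = 0) (m : M) : liftDiscrete (k := k) φ n h (ofM k M m) = φ m := by
  classical
  rw [liftDiscrete_apply]
  by_cases hm : wt m ≤ n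
  · rw [Finset.sum_eq_single_of_mem m (mem_ball.2 hm)]
    · simp [coeff_ofM]
    · intro b _ hb
      simp [coeff_ofM, hb]
  · rw [h m (by omega)]
    refine Finset.sum_eq_zero fun b hb => ?_
    rw [coeff_ofM, if_neg, zero_smul]
    rintro rfl
    exact hm (mem_ball.1 hb)

theorem liftDiscrete_eq_zero {B : Type*} [Ring B] [Algebra k B] (φ : M →* B) (n : ℕ)
    (h : ∀ m, n ≤ wt m → φ m = 0) {f : Series k M} (hf : f ∈ (fil k n : Ideal (Series k M))) :
    liftDiscrete φ n h f = 0 := by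
  rw [liftDiscrete_apply]
  refine Finset.sum_eq_zero fun m hm => ?_
  rcases lt_or_ge (wt m) n with h1 | h1
  · rw [hf m h1, zero_smul]
  · rw [h m h1, smul_zero]

section liftSq
variable {A : Type*} [Ring A] [Algebra k A] [FilteredAlgebra k A]

/-- The component at level `n` of the morphism `liftSq`. -/
noncomputable def liftLevel (φ : M →* TensorSq k A)
    (h : ∀ m n, (φ m).1 n ∈ sqFil k A n (wt m)) (n : ℕ) :
    Series k M →ₐ[k] Quo k A n ⊗[k] Quo k A n :=
  liftDiscrete ((Pi.evalMonoidHom (fun n => Quo k A n ⊗[k] Quo k A n) n).comp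
    ((TensorSq k A).val.toMonoidHom.comp φ)) (2 * n) fun m hm => sqFil_eq_zero hm (h m n)

theorem liftLevel_ofM (φ : M →* TensorSq k A)
    (h : ∀ m n, (φ m).1 n ∈ sqFil k A n (wt m)) (n : ℕ) (m : M) :
    liftLevel φ h n (ofM k M m) = (φ m).1 n := liftDiscrete_ofM _ _ _ _

theorem liftLevel_eq_zero (φ : M →* TensorSq k A)
    (h : ∀ m n, (φ m).1 n ∈ sqFil k A n (wt m)) (n : ℕ) {f : Series k M}
    (hf : f ∈ (fil k (2 * n) : Ideal (Series k M))) : liftLevel φ h n f = 0 :=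
  liftDiscrete_eq_zero _ _ _ hf

theorem trans_liftLevel (φ : M →* TensorSq k A)
    (h : ∀ m n, (φ m).1 n ∈ sqFil k A n (wt m)) (n : ℕ) :
    (trans k A n).toLinearMap ∘ₗ (liftLevel φ h (n + 1)).toLinearMap =
      (liftLevel φ h n).toLinearMap := by
  refine linearMap_ext (2 * (n + 1)) ?_ ?_ ?_
  · intro a ha
    simp only [LinearMap.comp_apply, AlgHom.toLinearMap_apply]
    rw [liftLevel_eq_zero φ h _ ha, map_zero]
  · intro a ha
    exact liftLevel_eq_zero φ h _ (anti (k := k) (by omega) ha)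
  · intro m
    simp only [LinearMap.comp_apply, AlgHom.toLinearMap_apply, liftLevel_ofM]
    exact (φ m).2 n

/-- The continuous algebra morphism `Series k M → A ⊗̂ A` extending a morphism of monoids
compatible with degrees. -/
noncomputable def liftSq (φ : M →* TensorSq k A) (h : ∀ m n, (φ m).1 n ∈ sqFil k A n (wt m)) :
    Series k M →ₐ[k] TensorSq k A :=
  AlgHom.codRestrict (AlgHom.pi fun n => liftLevel φ h n)
    (TensorSq k A) fun f n => DFunLike.congr_fun (trans_liftLevel φ h n) f

theorem liftSq_ofM (φ : M →* TensorSq k A) (h : ∀ m n, (φ m).1 n ∈ sqFil k A n (wt m)) (m : M) :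
    liftSq φ h (ofM k M m) = φ m := by
  ext n
  exact liftLevel_ofM φ h n m

end liftSq

/-- Continuity of a morphism to the completed tensor square. -/
def ContSq {A B : Type*} [Ring A] [Algebra k A] [FilteredAlgebra k A]
    [Ring B] [Algebra k B] [FilteredAlgebra k B] (D : A →ₐ[k] TensorSq k B) : Prop :=
  ∀ n, ∃ N, ∀ a ∈ (fil k N : Ideal A), (D a).1 n = 0

theorem contSq_liftSq {A : Type*} [Ring A] [Algebra k A] [FilteredAlgebra k A]
    (φ : M →* TensorSq k A) (h : ∀ m n, (φ m).1 n ∈ sqFil k A n (wt m)) :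
    ContSq (liftSq φ h) := fun n => ⟨2 * n, fun _ ha => liftLevel_eq_zero φ h n ha⟩

theorem ContSq.comp_filtered {A B C : Type*} [Ring A] [Algebra k A] [FilteredAlgebra k A]
    [Ring B] [Algebra k B] [FilteredAlgebra k B] [Ring C] [Algebra k C] [FilteredAlgebra k C]
    {D : B →ₐ[k] TensorSq k C}
    (hD : ContSq D) {f : A →ₐ[k] B} (hf : IsFiltered k f) : ContSq (D.comp f) := fun n => by
  obtain ⟨N, hN⟩ := hD n
  exact ⟨N, fun a ha => hN _ (hf N a ha)⟩

theorem ContSq.mapSq_comp {A B C : Type*} [Ring A] [Algebra k A] [FilteredAlgebra k A]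
    [Ring B] [Algebra k B] [FilteredAlgebra k B] [Ring C] [Algebra k C] [FilteredAlgebra k C]
    {D : A →ₐ[k] TensorSq k B}
    (hD : ContSq D) {f : B →ₐ[k] C} (hf : IsFiltered k f) : ContSq ((mapSq f hf).comp D) :=
  fun n => by
  obtain ⟨N, hN⟩ := hD n
  refine ⟨N, fun a ha => ?_⟩
  rw [AlgHom.comp_apply, mapSq_apply, hN a ha, map_zero]

theorem ContSq.ext {A : Type*} [Ring A] [Algebra k A] [FilteredAlgebra k A]
    {D D' : Series k M →ₐ[k] TensorSq k A} (hD : ContSq D) (hD' : ContSq D')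
    (h : ∀ m, D (ofM k M m) = D' (ofM k M m)) : D = D' := by
  ext a n
  obtain ⟨N, hN⟩ := hD n
  obtain ⟨N', hN'⟩ := hD' n
  let ev := (Pi.evalAlgHom k (fun n => Quo k A n ⊗[k] Quo k A n) n).comp (TensorSq k A).val
  exact DFunLike.congr_fun (linearMap_ext (f := (ev.comp D).toLinearMap)
    (g := (ev.comp D').toLinearMap) (max N N')
    (fun a ha => hN a (anti (k := k) (le_max_left _ _) ha))
    (fun a ha => hN' a (anti (k := k) (le_max_right _ _) ha))
    (fun m => congrArg ev (h m))) a

theorem filtered_ext {f g : Series k M →ₐ[k] Series k N} (hf : IsFiltered k f)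
    (hg : IsFiltered k g) (h : ∀ m, f (ofM k M m) = g (ofM k M m)) : f = g := by
  ext a p
  let ev : Series k N →ₗ[k] k := ⟨⟨fun a => a.coeff p, fun _ _ => rfl⟩, fun _ _ => rfl⟩
  exact DFunLike.congr_fun (linearMap_ext (f := ev ∘ₗ f.toLinearMap)
    (g := ev ∘ₗ g.toLinearMap) (wt p + 1)
    (fun a ha => hf _ a ha p (by omega))
    (fun a ha => hg _ a ha p (by omega))
    (fun m => congrArg ev (h m))) a

/-- The continuous algebra morphism `f ↦ ∑ m, (f | m) φ m` extending a morphism of monoids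
compatible with degrees. -/
noncomputable def lift (φ : M →* Series k N)
    (h : ∀ m, φ m ∈ (fil k (wt m) : Ideal (Series k N))) : Series k M →ₐ[k] Series k N :=
  let T (n : ℕ) : Series k M →ₐ[k] Quo k (Series k N) n :=
    liftDiscrete ((toQuo k (Series k N) n).toMonoidHom.comp φ) n fun m hm =>
      Ideal.Quotient.eq_zero_iff_mem.2 (anti (k := k) hm (h m))
  let E : Series k M → Series k N := fun f p => ∑ m ∈ ball M (wt p), f.coeff m * (φ m).coeff p
  have hE : ∀ f n, toQuo k (Series k N) n (E f) = T n f := fun f n => by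
    change _ = ∑ m ∈ ball M n, f.coeff m • toQuo k (Series k N) n (φ m)
    simp only [← map_smul, ← map_sum]
    refine Ideal.Quotient.eq.2 fun p hp => ?_
    rw [coeff_sub, coeff_sum, sub_eq_zero]
    change ∑ m ∈ ball M (wt p), f.coeff m * (φ m).coeff p = ∑ m ∈ ball M n, f.coeff m * _
    refine Finset.sum_subset (fun m hm => mem_ball.2 ((mem_ball.1 hm).trans hp.le)) ?_
    intro m _ hm
    rw [h m p (by rw [mem_ball] at hm; omega), mul_zero]
  have sep : ∀ a b : Series k N,
      (∀ n, toQuo k (Series k N) n a = toQuo k (Series k N) n b) → a = b := fun a b hab => by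
    ext p
    exact sub_eq_zero.1 (Ideal.Quotient.eq.1 (hab (wt p + 1)) p (Nat.lt_succ_self _))
  AlgHom.ofLinearMap
    { toFun := E
      map_add' := fun f g => sep _ _ fun n => by simp only [map_add, hE]
      map_smul' := fun r f => sep _ _ fun n => by simp only [map_smul, hE, RingHom.id_apply] }
    (sep _ _ fun n => (hE _ n).trans (by rw [map_one, map_one]))
    (fun f g => sep _ _ fun n => (hE _ n).trans (by
      rw [map_mul, map_mul]; exact congrArg₂ _ (hE f n).symm (hE g n).symm))

theorem coeff_lift (φ : M →* Series k N)
    (h : ∀ m, φ m ∈ (fil k (wt m) : Ideal (Series k N))) (f : Series k M) (p : N) :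
    (lift φ h f).coeff p = ∑ m ∈ ball M (wt p), f.coeff m * (φ m).coeff p := rfl

theorem lift_ofM (φ : M →* Series k N)
    (h : ∀ m, φ m ∈ (fil k (wt m) : Ideal (Series k N))) (m : M) :
    lift φ h (ofM k M m) = φ m := by
  classical
  ext p
  rw [coeff_lift]
  by_cases hm : wt m ≤ wt p
  · rw [Finset.sum_eq_single_of_mem m (mem_ball.2 hm)]
    · simp [coeff_ofM]
    · intro b _ hb
      simp [coeff_ofM, hb]
  · rw [h m p (by omega)]
    refine Finset.sum_eq_zero fun b hb => ?_
    rw [coeff_ofM, if_neg, zero_mul]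
    rintro rfl
    exact hm (mem_ball.1 hb)

theorem isFiltered_lift (φ : M →* Series k N)
    (h : ∀ m, φ m ∈ (fil k (wt m) : Ideal (Series k N))) : IsFiltered k (lift φ h) := by
  intro n f hf p hp
  rw [coeff_lift]
  refine Finset.sum_eq_zero fun m hm => ?_
  rw [hf m (by rw [mem_ball] at hm; omega), zero_mul]

end Series

open WeightedMonoid FilteredAlgebra

/-- An alphabet whose letters have positive degrees, with finitely many letters in each degree. -/
class GradedAlphabet (α : Type*) where
  deg : α → ℕ
  deg_pos : ∀ a, 0 < deg a
  finite_deg : ∀ n, {a : α | deg a ≤ n}.Finite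

namespace GradedAlphabet
variable {α : Type*} [GradedAlphabet α]

/-- The weight of a word is the sum of the degrees of its letters. -/
def wordWt (w : FreeMonoid α) : ℕ := (w.toList.map deg).sum

theorem wordWt_of_mul (a : α) (w : FreeMonoid α) :
    wordWt (FreeMonoid.of a * w) = deg a + wordWt w := by
  simp [wordWt]

theorem finite_wordWt (n : ℕ) : {w : FreeMonoid α | wordWt w ≤ n}.Finite := by
  induction n using Nat.strong_induction_on with
  | _ n ih =>
    rcases n with _ | n
    · refine (Set.finite_singleton (1 : FreeMonoid α)).subset fun w hw => ?_
      cases w using FreeMonoid.casesOn with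
      | one => rfl
      | of_mul a w =>
        have := deg_pos a
        have hw' : wordWt (FreeMonoid.of a * w) ≤ 0 := hw
        rw [wordWt_of_mul] at hw'
        omega
    · refine ((Set.finite_singleton (1 : FreeMonoid α)).union
        (((finite_deg (α := α) (n + 1)).prod (ih n (Nat.lt_succ_self n))).image
          fun p => FreeMonoid.of p.1 * p.2)).subset fun w hw => ?_
      cases w using FreeMonoid.casesOn with
      | one => exact Or.inl rfl
      | of_mul a w =>
        have := deg_pos a
        have hw' : wordWt (FreeMonoid.of a * w) ≤ n + 1 := hw
        rw [wordWt_of_mul] at hw'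
        exact Or.inr ⟨(a, w), ⟨by change deg a ≤ n + 1; omega, by change wordWt w ≤ n; omega⟩, rfl⟩

instance : WeightedMonoid (FreeMonoid α) where
  toMonoid := inferInstance
  wt := wordWt
  wt_mul a b := by simp [wordWt]
  finite_wt := finite_wordWt

theorem wt_of (a : α) : wt (FreeMonoid.of a) = deg a := by
  change wordWt (FreeMonoid.of a) = deg a
  simp [wordWt]

theorem wt_of_mul (a : α) (w : FreeMonoid α) : wt (FreeMonoid.of a * w) = deg a + wt w :=
  wordWt_of_mul a w

end GradedAlphabet

open GradedAlphabet

namespace Series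
variable {k : Type*} [CommRing k] {α : Type*} [GradedAlphabet α]

theorem mem_fil_zero {N : Type*} [WeightedMonoid N] (a : Series k N) :
    a ∈ (fil k 0 : Ideal (Series k N)) := fun _ hm => absurd hm (Nat.not_lt_zero _)

/-- The letter `a`, as a formal series. -/
noncomputable def letter (k : Type*) [CommRing k] (a : α) : Series k (FreeMonoid α) :=
  ofM k _ (FreeMonoid.of a)

theorem letter_mem_fil (a : α) :
    letter k a ∈ (fil k (deg a) : Ideal (Series k (FreeMonoid α))) := by
  have := ofM_mem_fil (k := k) (FreeMonoid.of a)
  rwa [wt_of] at this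

theorem word_mem_fil {A : Type*} [Ring A] [Algebra k A] [FilteredAlgebra k A] (f : α → A)
    (hf : ∀ a, f a ∈ (fil k (deg a) : Ideal A)) (w : FreeMonoid α) :
    FreeMonoid.lift f w ∈ (fil k (wt w) : Ideal A) := by
  induction w using FreeMonoid.inductionOn' with
  | one => rw [wt_one, fil_zero]; trivial
  | of_mul a w ih =>
    rw [map_mul, FreeMonoid.lift_eval_of, wt_of_mul]
    exact fil_mul (hf a) ih

/-- The continuous algebra morphism from noncommutative formal series given on letters. -/
noncomputable def liftFree {N : Type*} [WeightedMonoid N] (f : α → Series k N)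
    (hf : ∀ a, f a ∈ (fil k (deg a) : Ideal (Series k N))) :
    Series k (FreeMonoid α) →ₐ[k] Series k N :=
  lift (FreeMonoid.lift f) (word_mem_fil f hf)

theorem isFiltered_liftFree {N : Type*} [WeightedMonoid N] (f : α → Series k N)
    (hf : ∀ a, f a ∈ (fil k (deg a) : Ideal (Series k N))) : IsFiltered k (liftFree f hf) :=
  isFiltered_lift _ _

theorem liftFree_letter {N : Type*} [WeightedMonoid N] (f : α → Series k N)
    (hf : ∀ a, f a ∈ (fil k (deg a) : Ideal (Series k N))) (a : α) :
    liftFree f hf (letter k a) = f a := by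
  rw [liftFree, letter, lift_ofM, FreeMonoid.lift_eval_of]

theorem word_mem_sqFil {A : Type*} [Ring A] [Algebra k A] [FilteredAlgebra k A]
    (f : α → TensorSq k A) (hf : ∀ a n, (f a).1 n ∈ sqFil k A n (deg a)) (w : FreeMonoid α)
    (n : ℕ) : (FreeMonoid.lift f w).1 n ∈ sqFil k A n (wt w) := by
  induction w using FreeMonoid.inductionOn' with
  | one => rw [wt_one]; exact one_mem_sqFil n
  | of_mul a w ih =>
    rw [map_mul, FreeMonoid.lift_eval_of, wt_of_mul]
    exact sqFil_mul (hf a n) ih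

/-- The continuous algebra morphism from noncommutative formal series to a completed tensor square
given on letters. -/
noncomputable def liftSqFree {A : Type*} [Ring A] [Algebra k A] [FilteredAlgebra k A]
    (f : α → TensorSq k A) (hf : ∀ a n, (f a).1 n ∈ sqFil k A n (deg a)) :
    Series k (FreeMonoid α) →ₐ[k] TensorSq k A :=
  liftSq (FreeMonoid.lift f) (word_mem_sqFil f hf)

theorem contSq_liftSqFree {A : Type*} [Ring A] [Algebra k A] [FilteredAlgebra k A]
    (f : α → TensorSq k A) (hf : ∀ a n, (f a).1 n ∈ sqFil k A n (deg a)) :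
    ContSq (liftSqFree f hf) := contSq_liftSq _ _

theorem liftSqFree_letter {A : Type*} [Ring A] [Algebra k A] [FilteredAlgebra k A]
    (f : α → TensorSq k A) (hf : ∀ a n, (f a).1 n ∈ sqFil k A n (deg a)) (a : α) :
    liftSqFree f hf (letter k a) = f a := by
  rw [liftSqFree, letter, liftSq_ofM, FreeMonoid.lift_eval_of]

theorem hom_ofM_ext {B : Type*} [Semiring B] [Algebra k B] {f g : Series k (FreeMonoid α) →ₐ[k] B}
    (h : ∀ a, f (letter k a) = g (letter k a)) (w : FreeMonoid α) :
    f (ofM k _ w) = g (ofM k _ w) := by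
  have : (f : Series k (FreeMonoid α) →* B).comp (ofM k _) =
      (g : Series k (FreeMonoid α) →* B).comp (ofM k _) := FreeMonoid.hom_eq h
  exact DFunLike.congr_fun this w

/-- A filtered morphism on noncommutative formal series is determined by its values on letters. -/
theorem free_ext {N : Type*} [WeightedMonoid N] {f g : Series k (FreeMonoid α) →ₐ[k] Series k N}
    (hf : IsFiltered k f) (hg : IsFiltered k g) (h : ∀ a, f (letter k a) = g (letter k a)) :
    f = g := filtered_ext hf hg (hom_ofM_ext h)

theorem freeSq_ext {A : Type*} [Ring A] [Algebra k A] [FilteredAlgebra k A]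
    {D D' : Series k (FreeMonoid α) →ₐ[k] TensorSq k A} (hD : ContSq D) (hD' : ContSq D')
    (h : ∀ a, D (letter k a) = D' (letter k a)) : D = D' := ContSq.ext hD hD' fun w => hom_ofM_ext h w

theorem eq_zero_of_mem_fil {N : Type*} [WeightedMonoid N] {a : Series k N}
    (h : ∀ n, a ∈ (fil k n : Ideal (Series k N))) : a = 0 := by
  ext p
  exact h (wt p + 1) p (Nat.lt_succ_self _)

section unipotent

variable {N : Type*} [WeightedMonoid N] (f : Series k N →ₐ[k] Series k N)

/-- `f` induces the identity on the associated graded algebra. -/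
def Unipotent : Prop :=
  ∀ n a, a ∈ (fil k n : Ideal (Series k N)) → f a - a ∈ (fil k (n + 1) : Ideal (Series k N))

theorem unipotent_mem (hu : Unipotent f) {n : ℕ} {a : Series k N}
    (ha : f a ∈ (fil k n : Ideal (Series k N))) : a ∈ (fil k n : Ideal (Series k N)) := by
  have : ∀ i ≤ n, a ∈ (fil k i : Ideal (Series k N)) := by
    intro i
    induction i with
    | zero => intro _; exact mem_fil_zero a
    | succ i ih =>
      intro hi
      have h1 := hu i a (ih (by omega))
      have h2 : f a ∈ (fil k (i + 1) : Ideal (Series k N)) := anti (k := k) hi ha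
      have := sub_mem h2 h1
      rwa [sub_sub_cancel] at this
  exact this n le_rfl

theorem unipotent_surjective (hu : Unipotent f) : Function.Surjective f := by
  intro b
  let s : ℕ → Series k N := fun i => Nat.rec 0 (fun _ a => a + (b - f a)) i
  have hs : ∀ i, s (i + 1) = s i + (b - f (s i)) := fun i => rfl
  have h1 : ∀ i, b - f (s i) ∈ (fil k i : Ideal (Series k N)) := by
    intro i
    induction i with
    | zero => exact mem_fil_zero _
    | succ i ih =>
      have := neg_mem (hu i _ ih)
      rw [hs, map_add]
      convert this using 1
      abel
  have h2 : ∀ i j, i ≤ j → s j - s i ∈ (fil k i : Ideal (Series k N)) := by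
    intro i j hij
    induction j, hij using Nat.le_induction with
    | base => rw [sub_self]; exact zero_mem _
    | succ j hj ih =>
      have h3 : b - f (s j) ∈ (fil k i : Ideal (Series k N)) := anti (k := k) hj (h1 j)
      have := add_mem ih h3
      rw [hs]
      convert this using 1
      abel
  let a : Series k N := fun m => (s (wt m + 1)).coeff m
  have h3 : ∀ i, a - s i ∈ (fil k i : Ideal (Series k N)) := by
    intro i m hm
    have := h2 (wt m + 1) i hm m (Nat.lt_succ_self _)
    rw [coeff_sub] at this ⊢
    rw [← neg_sub]
    exact (congrArg Neg.neg this).trans neg_zero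
  have hf : ∀ n c, c ∈ (fil k n : Ideal (Series k N)) → f c ∈ (fil k n : Ideal (Series k N)) := by
    intro n c hc
    have h4 : f c - c ∈ (fil k n : Ideal (Series k N)) := anti (k := k) n.le_succ (hu n c hc)
    have := add_mem h4 hc
    rwa [sub_add_cancel] at this
  refine ⟨a, ?_⟩
  rw [eq_comm, ← sub_eq_zero]
  refine eq_zero_of_mem_fil fun n => ?_
  have := sub_mem (h1 n) (hf n _ (h3 n))
  rw [map_sub] at this
  convert this using 1
  abel

theorem unipotent_bijective (hu : Unipotent f) : Function.Bijective f := by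
  refine ⟨?_, unipotent_surjective f hu⟩
  rw [injective_iff_map_eq_zero]
  intro a ha
  refine eq_zero_of_mem_fil fun n => unipotent_mem f hu ?_
  rw [ha]; exact zero_mem _

end unipotent

theorem unipotent_of_letters (f : Series k (FreeMonoid α) →ₐ[k] Series k (FreeMonoid α))
    (hf : IsFiltered k f)
    (h : ∀ a, f (letter k a) - letter k a ∈
      (fil k (deg a + 1) : Ideal (Series k (FreeMonoid α)))) (n : ℕ)
    (a : Series k (FreeMonoid α)) (ha : a ∈ (fil k n : Ideal (Series k (FreeMonoid α)))) :
    f a - a ∈ (fil k (n + 1) : Ideal (Series k (FreeMonoid α))) := by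
  have hw : ∀ w : FreeMonoid α, f (ofM k _ w) - ofM k _ w ∈
      (fil k (wt w + 1) : Ideal (Series k (FreeMonoid α))) := by
    intro w
    induction w using FreeMonoid.inductionOn' with
    | one => simp
    | of_mul x w ih =>
      have e : f (ofM k _ (FreeMonoid.of x * w)) - ofM k _ (FreeMonoid.of x * w) =
          (f (letter k x) - letter k x) * f (ofM k _ w) +
            letter k x * (f (ofM k _ w) - ofM k _ w) := by
        rw [map_mul (ofM k _), map_mul f]
        change f (letter k x) * _ - letter k x * _ = _
        noncomm_ring
      rw [e, wt_of_mul]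
      refine add_mem ?_ ?_
      · have := fil_mul (h x) (hf _ _ (ofM_mem_fil w))
        rwa [show deg x + wt w + 1 = deg x + 1 + wt w by ring]
      · have := fil_mul (letter_mem_fil x) ih
        rwa [add_assoc]
  have h0 := sub_sum_mem a n
  have h1 := sub_mem (hf _ _ h0) h0
  set S := ∑ m ∈ ball (FreeMonoid α) n, a.coeff m • ofM k _ m
  have h2 : f S - S ∈ (fil k (n + 1) : Ideal (Series k (FreeMonoid α))) := by
    rw [map_sum, ← Finset.sum_sub_distrib]
    refine sum_mem fun m hm => ?_
    rw [map_smul, ← smul_sub]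
    rcases lt_or_ge (wt m) n with h3 | h3
    · rw [ha m h3, zero_smul]; exact zero_mem _
    · intro p hp
      rw [coeff_smul, hw m p (by omega), mul_zero]
  have := add_mem h1 h2
  rw [map_sub] at this
  convert this using 1
  abel

end Series

open Series

section

/-- The alphabet `X = {x₀} ⊔ {x_g | g ∈ G}`, with `x₀ = none` and `x_g = some g`, all of degree
one. -/
instance {G : Type*} [Finite G] : GradedAlphabet (Option G) where
  deg _ := 1
  deg_pos _ := Nat.one_pos
  finite_deg _ := Set.toFinite _

/-- The algebra `k⟨⟨X⟩⟩`. -/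
abbrev KX (k G : Type*) : Type _ := Series k (FreeMonoid (Option G))

variable (k : Type*) [CommRing k] {G : Type*} [CommGroup G] [Fintype G]

/-- The letter `x₀`. -/
noncomputable def x₀ : KX k G := letter k none
/-- The letter `x_g`. -/
noncomputable def x (g : G) : KX k G := letter k (some g)

theorem x₀_mem : x₀ k ∈ (fil k 1 : Ideal (KX k G)) := letter_mem_fil none
theorem x_mem (g : G) : x k g ∈ (fil k 1 : Ideal (KX k G)) := letter_mem_fil (some g)

theorem kx_ext {N : Type*} [WeightedMonoid N] {f g : KX k G →ₐ[k] Series k N}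
    (hf : IsFiltered k f) (hg : IsFiltered k g) (h0 : f (x₀ k) = g (x₀ k))
    (h : ∀ a, f (x k a) = g (x k a)) : f = g :=
  free_ext hf hg fun a => by cases a with | none => exact h0 | some a => exact h a

theorem kx_ext_sq {A : Type*} [Ring A] [Algebra k A] [FilteredAlgebra k A]
    {f g : KX k G →ₐ[k] TensorSq k A}
    (hf : ContSq f) (hg : ContSq g) (h0 : f (x₀ k) = g (x₀ k))
    (h : ∀ a, f (x k a) = g (x k a)) : f = g :=
  freeSq_ext hf hg fun a => by cases a with | none => exact h0 | some a => exact h a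

/-- The continuous algebra automorphism `t_g : x₀ ↦ x₀, x_h ↦ x_{gh}` of `k⟨⟨X⟩⟩`. -/
noncomputable def t (g : G) : KX k G →ₐ[k] KX k G :=
  liftFree (fun | none => x₀ k | some h => x k (g * h))
    (fun | none => x₀_mem k | some h => x_mem k (g * h))

theorem isFiltered_t (g : G) : IsFiltered k (t k g) := isFiltered_liftFree _ _
@[simp] theorem t_x₀ (g : G) : t k g (x₀ k) = x₀ k := liftFree_letter _ _ _
@[simp] theorem t_x (g h : G) : t k g (x k h) = x k (g * h) := liftFree_letter _ _ _

theorem t_one : t k (1 : G) = AlgHom.id k _ :=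
  kx_ext k (isFiltered_t k 1) IsFiltered.id (by simp) (by simp)

theorem t_mul (g h : G) : t k (g * h) = (t k g).comp (t k h) :=
  kx_ext k (isFiltered_t k _) ((isFiltered_t k _).comp (isFiltered_t k _)) (by simp)
    (by simp [mul_assoc])

section generic

variable {k : Type*} [CommRing k] {A : Type*} [Ring A] [Algebra k A] [FilteredAlgebra k A]
  (D : A →ₐ[k] TensorSq k A) (f : A →ₐ[k] A) (hf : IsFiltered k f)

theorem coprod_primitive {b : A} (hb : D b = tmul k b 1 + tmul k 1 b)
    (hb' : D (f b) = tmul k (f b) 1 + tmul k 1 (f b)) : D.comp f b = (mapSq f hf).comp D b := by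
  rw [AlgHom.comp_apply, AlgHom.comp_apply, hb, map_add, mapSq_tmul, mapSq_tmul, map_one, hb']

theorem coprod_conj_primitive {a b c : A}
    (h : a * c = 1) (hb : D b = tmul k b 1 + tmul k 1 b) (ha : D a = tmul k a a)
    (hc : D c = tmul k c c) (e : f b = a * b * c) :
    D.comp f b = (mapSq f hf).comp D b := by
  rw [AlgHom.comp_apply, AlgHom.comp_apply, hb, map_add, mapSq_tmul, mapSq_tmul, map_one, e,
    map_mul, map_mul, ha, hb, hc, mul_add, add_mul, tmul_mul_tmul, tmul_mul_tmul, tmul_mul_tmul,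
    tmul_mul_tmul, mul_one, h]

theorem grouplike_map {a : A} (h : D.comp f = (mapSq f hf).comp D) (ha : D a = tmul k a a) :
    D (f a) = tmul k (f a) (f a) := by
  have := DFunLike.congr_fun h a
  rwa [AlgHom.comp_apply, AlgHom.comp_apply, ha, mapSq_tmul] at this

theorem grouplike_mul {a b : A} (ha : D a = tmul k a a) (hb : D b = tmul k b b) :
    D (a * b) = tmul k (a * b) (a * b) := by
  rw [map_mul, ha, hb, tmul_mul_tmul]

theorem grouplike_one : D 1 = tmul k 1 1 := by rw [map_one, tmul_one_one]

theorem grouplike_inv {a b : A} (hab : a * b = 1) (hba : b * a = 1)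
    (h : D a = tmul k a a) : D b = tmul k b b := by
  have h1 : D a * D b = 1 := by rw [← map_mul, hab, map_one]
  have h2 : tmul k b b * D a = 1 := by
    rw [h, tmul_mul_tmul, hba, tmul_one_one]
  calc D b = (tmul k b b * D a) * D b := by rw [h2, one_mul]
    _ = tmul k b b := by rw [mul_assoc, h1, mul_one]

theorem grouplike_of_map {a : A} (g : A →ₐ[k] A) (hg : IsFiltered k g) (hgf : ∀ c, g (f c) = c)
    (h : D.comp f = (mapSq f hf).comp D) (ha : D (f a) = tmul k (f a) (f a)) :
    D a = tmul k a a := by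
  have h1 := DFunLike.congr_fun h a
  rw [AlgHom.comp_apply, AlgHom.comp_apply, ha] at h1
  have h2 := congrArg (mapSq _ hg) h1
  rw [mapSq_tmul, ← AlgHom.comp_apply (mapSq _ hg), ← mapSq_comp, hgf] at h2
  have h4 : mapSq (g.comp f) (hg.comp hf) = AlgHom.id k _ := by
    rw [← mapSq_id]; congr 1; exact AlgHom.ext hgf
  rw [h4] at h2
  exact h2.symm

variable (ε : A →ₐ[k] k) (hε : ∀ a, a ∈ (fil k 1 : Ideal A) → ε a = 0)

/-- The morphism `ε ⊗ ε` induced by an augmentation `ε`. -/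
noncomputable def augSq : TensorSq k A →ₐ[k] k :=
  ((Algebra.TensorProduct.lift (Ideal.Quotient.liftₐ (fil k 1) ε hε)
    (Ideal.Quotient.liftₐ (fil k 1) ε hε) fun _ _ => Commute.all _ _).comp
    (Pi.evalAlgHom k (fun n => Quo k A n ⊗[k] Quo k A n) 1)).comp (TensorSq k A).val

theorem augSq_tmul (a b : A) : augSq ε hε (tmul k a b) = ε a * ε b :=
  Algebra.TensorProduct.lift_tmul _ _ (fun _ _ => Commute.all _ _) _ _

theorem augSq_eq_zero {s : TensorSq k A} (h : s.1 1 = 0) : augSq ε hε s = 0 := by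
  change Algebra.TensorProduct.lift _ _ (fun _ _ => Commute.all _ _) (s.1 1) = 0
  rw [h, map_zero]

theorem augSq_primitive {a : A} (h0 : ε a = 0) (h : D a = tmul k a 1 + tmul k 1 a) :
    (augSq ε hε).comp D a = ε a := by
  rw [AlgHom.comp_apply, h, map_add, augSq_tmul, augSq_tmul, h0]
  simp

theorem augSq_grouplike {a : A} (h0 : augSq ε hε (D a) = ε a) (h : D a = tmul k a a) :
    ε a * ε a = ε a := by
  rw [← augSq_tmul ε hε, ← h, h0]

end generic

/-- The coproduct `Δ̂` of `k⟨⟨X⟩⟩` for which all letters are primitive. -/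
noncomputable def coprodX : KX k G →ₐ[k] TensorSq k (KX k G) :=
  liftSqFree (fun a => tmul k (letter k a) 1 + tmul k 1 (letter k a)) fun a n =>
    add_mem (tmul_mem_sqFil (letter_mem_fil a) (mem_fil_zero 1) (by omega))
      (tmul_mem_sqFil (mem_fil_zero 1) (letter_mem_fil a) (by omega))

theorem contSq_coprodX : ContSq (coprodX k (G := G)) := contSq_liftSqFree _ _
theorem coprodX_letter (a : Option G) : coprodX k (letter k a) =
    tmul k (letter k a) 1 + tmul k 1 (letter k a) := liftSqFree_letter _ _ _
theorem coprodX_x₀ : coprodX k (x₀ k : KX k G) = tmul k (x₀ k) 1 + tmul k 1 (x₀ k) :=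
  coprodX_letter k none
theorem coprodX_x (g : G) : coprodX k (x k g) = tmul k (x k g) 1 + tmul k 1 (x k g) :=
  coprodX_letter k (some g)

theorem coprodX_t (g : G) :
    (coprodX k).comp (t k g) = (mapSq (t k g) (isFiltered_t k g)).comp (coprodX k) := by
  refine kx_ext_sq k ((contSq_coprodX k).comp_filtered (isFiltered_t k g))
    ((contSq_coprodX k).mapSq_comp (isFiltered_t k g)) ?_ fun h => ?_
  · exact coprod_primitive (coprodX k) (t k g) (isFiltered_t k g) (coprodX_x₀ k)
      (by rw [t_x₀]; exact coprodX_x₀ k)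
  · exact coprod_primitive (coprodX k) (t k g) (isFiltered_t k g) (coprodX_x k h)
      (by rw [t_x]; exact coprodX_x k (g * h))

variable (G) in
/-- The set `𝒢(k⟨⟨X⟩⟩)` of invertible series `Ψ` with `Δ̂(Ψ) = Ψ ⊗ Ψ`. -/
@[ext] structure GrpLike where
  toUnits : (KX k G)ˣ
  grouplike : coprodX k (toUnits : KX k G) = tmul k (toUnits : KX k G) (toUnits : KX k G)

variable {k}

/-- The series underlying a grouplike element. -/
noncomputable def GrpLike.val (Ψ : GrpLike k G) : KX k G := (Ψ.toUnits : KX k G)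
/-- The inverse, for the product of series, of a grouplike element. -/
noncomputable def GrpLike.inv (Ψ : GrpLike k G) : KX k G := ((Ψ.toUnits⁻¹ : (KX k G)ˣ) : KX k G)

theorem GrpLike.val_inv (Ψ : GrpLike k G) : Ψ.val * Ψ.inv = 1 := Units.mul_inv _
theorem GrpLike.inv_val (Ψ : GrpLike k G) : Ψ.inv * Ψ.val = 1 := Units.inv_mul _
theorem GrpLike.coprod_val (Ψ : GrpLike k G) : coprodX k Ψ.val = tmul k Ψ.val Ψ.val := Ψ.grouplike

theorem GrpLike.coprod_inv (Ψ : GrpLike k G) : coprodX k Ψ.inv = tmul k Ψ.inv Ψ.inv :=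
  grouplike_inv (coprodX k) Ψ.val_inv Ψ.inv_val Ψ.coprod_val

theorem coprod_t {a : KX k G} (h : coprodX k a = tmul k a a) (g : G) :
    coprodX k (t k g a) = tmul k (t k g a) (t k g a) :=
  grouplike_map (coprodX k) (t k g) (isFiltered_t k g) (coprodX_t k g) h

theorem conj_mem {N : Type*} [WeightedMonoid N] {a b c : Series k N} {n : ℕ}
    (hb : b ∈ (fil k n : Ideal (Series k N))) : a * b * c ∈ (fil k n : Ideal (Series k N)) :=
  Ideal.mul_mem_right _ _ (Ideal.mul_mem_left _ _ hb)

/-- The continuous algebra automorphism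
`aut_Ψ : x₀ ↦ x₀, x_g ↦ Ad_{t_g(Ψ⁻¹)}(x_g) = t_g(Ψ⁻¹) x_g t_g(Ψ)` of `k⟨⟨X⟩⟩`. -/
noncomputable def aut (Ψ : GrpLike k G) : KX k G →ₐ[k] KX k G :=
  liftFree (fun | none => x₀ k | some g => t k g Ψ.inv * x k g * t k g Ψ.val)
    (fun | none => x₀_mem k | some g => conj_mem (x_mem k g))

theorem isFiltered_aut (Ψ : GrpLike k G) : IsFiltered k (aut Ψ) := isFiltered_liftFree _ _
@[simp] theorem aut_x₀ (Ψ : GrpLike k G) : aut Ψ (x₀ k) = x₀ k := liftFree_letter _ _ _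
@[simp] theorem aut_x (Ψ : GrpLike k G) (g : G) :
    aut Ψ (x k g) = t k g Ψ.inv * x k g * t k g Ψ.val := liftFree_letter _ _ _

theorem aut_t (Ψ : GrpLike k G) (g : G) : (aut Ψ).comp (t k g) = (t k g).comp (aut Ψ) := by
  refine kx_ext k ((isFiltered_aut Ψ).comp (isFiltered_t k g))
    ((isFiltered_t k g).comp (isFiltered_aut Ψ)) (by simp) fun h => ?_
  simp [t_mul]

theorem coprodX_aut (Ψ : GrpLike k G) :
    (coprodX k).comp (aut Ψ) = (mapSq (aut Ψ) (isFiltered_aut Ψ)).comp (coprodX k) := by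
  refine kx_ext_sq k ((contSq_coprodX k).comp_filtered (isFiltered_aut Ψ))
    ((contSq_coprodX k).mapSq_comp (isFiltered_aut Ψ)) ?_ fun g => ?_
  · exact coprod_primitive (coprodX k) (aut Ψ) (isFiltered_aut Ψ) (coprodX_x₀ k)
      (by rw [aut_x₀]; exact coprodX_x₀ k)
  · exact coprod_conj_primitive (coprodX k) (aut Ψ) (isFiltered_aut Ψ)
      (by rw [← map_mul, Ψ.inv_val, map_one]) (coprodX_x k g) (coprod_t Ψ.coprod_inv g)
      (coprod_t Ψ.coprod_val g) (aut_x Ψ g)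

theorem coprod_aut (Ψ : GrpLike k G) {a : KX k G} (h : coprodX k a = tmul k a a) :
    coprodX k (aut Ψ a) = tmul k (aut Ψ a) (aut Ψ a) :=
  grouplike_map (coprodX k) (aut Ψ) (isFiltered_aut Ψ) (coprodX_aut Ψ) h

/-- The product `Ψ ⊛ Φ = S_Ψ(Φ) = Ψ aut_Ψ(Φ)`. -/
noncomputable instance : Mul (GrpLike k G) where
  mul Ψ Φ :=
    { toUnits := Ψ.toUnits * Units.map (aut Ψ : KX k G →* KX k G) Φ.toUnits
      grouplike := grouplike_mul (coprodX k) Ψ.coprod_val (coprod_aut Ψ Φ.coprod_val) }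

theorem GrpLike.val_mul (Ψ Φ : GrpLike k G) : (Ψ * Φ).val = Ψ.val * aut Ψ Φ.val := rfl

theorem GrpLike.inv_mul (Ψ Φ : GrpLike k G) : (Ψ * Φ).inv = aut Ψ Φ.inv * Ψ.inv := by
  change (((Ψ.toUnits * Units.map (aut Ψ : KX k G →* KX k G) Φ.toUnits)⁻¹ : (KX k G)ˣ) : KX k G) = _
  rw [mul_inv_rev]
  rfl

noncomputable instance : One (GrpLike k G) where
  one := { toUnits := 1, grouplike := grouplike_one (coprodX k) }

theorem GrpLike.val_one : (1 : GrpLike k G).val = 1 := rfl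
theorem GrpLike.inv_one : (1 : GrpLike k G).inv = 1 := by
  change (((1 : (KX k G)ˣ)⁻¹ : (KX k G)ˣ) : KX k G) = 1
  rw [_root_.inv_one]; rfl

theorem GrpLike.val_injective {Ψ Φ : GrpLike k G} (h : Ψ.val = Φ.val) : Ψ = Φ :=
  GrpLike.ext (Units.ext h)

theorem aut_mul (Ψ Φ : GrpLike k G) : aut (Ψ * Φ) = (aut Ψ).comp (aut Φ) := by
  refine kx_ext k (isFiltered_aut _) ((isFiltered_aut Ψ).comp (isFiltered_aut Φ)) (by simp)
    fun g => ?_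
  have h : ∀ a, aut Ψ (t k g a) = t k g (aut Ψ a) := DFunLike.congr_fun (aut_t Ψ g)
  simp [GrpLike.val_mul, GrpLike.inv_mul, h, mul_assoc]

theorem aut_one : aut (1 : GrpLike k G) = AlgHom.id k _ := by
  refine kx_ext k (isFiltered_aut _) IsFiltered.id (by simp) fun g => ?_
  simp [GrpLike.val_one, GrpLike.inv_one]

variable (k G) in
/-- The augmentation `k⟨⟨X⟩⟩ → k`, the constant term. -/
noncomputable def aug : KX k G →ₐ[k] k :=
  liftDiscrete (FreeMonoid.lift fun _ => 0) 1 fun m hm => by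
    cases m using FreeMonoid.casesOn with
    | one => rw [wt_one] at hm; omega
    | of_mul a w => rw [map_mul, FreeMonoid.lift_eval_of, zero_mul]

theorem aug_eq_zero {a : KX k G} (ha : a ∈ (fil k 1 : Ideal (KX k G))) : aug k G a = 0 :=
  liftDiscrete_eq_zero _ _ _ ha

theorem aug_letter (a : Option G) : aug k G (letter k a) = 0 :=
  aug_eq_zero (letter_mem_fil a)

theorem aug_t (g : G) (a : KX k G) : aug k G (t k g a) = aug k G a :=
  DFunLike.congr_fun (linearMap_ext (f := ((aug k G).comp (t k g)).toLinearMap)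
    (g := (aug k G).toLinearMap) 1 (fun a ha => aug_eq_zero (isFiltered_t k g 1 a ha))
    (fun a ha => aug_eq_zero ha)
    (fun w => hom_ofM_ext (f := (aug k G).comp (t k g)) (g := aug k G) (fun b => by
      cases b with
      | none =>
        change aug k G (t k g (x₀ k)) = aug k G (x₀ k)
        rw [t_x₀]
      | some b =>
        change aug k G (t k g (x k b)) = aug k G (x k b)
        rw [t_x]; exact (aug_letter _).trans (aug_letter _).symm) w)) a

theorem sub_aug_mem (a : KX k G) : a - algebraMap k _ (aug k G a) ∈ (fil k 1 : Ideal (KX k G)) := by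
  have h := sub_sum_mem a 0
  have h1 : ball (FreeMonoid (Option G)) 0 = {1} := by
    ext w
    rw [mem_ball, Finset.mem_singleton]
    cases w using FreeMonoid.casesOn with
    | one => simp [wt_one]
    | of_mul a w =>
      rw [wt_of_mul]
      have := deg_pos a
      constructor
      · intro h; omega
      · intro h
        have := congrArg (fun w => wt w) h
        simp only [wt_of_mul, wt_one] at this
        omega
  rw [h1, Finset.sum_singleton, map_one] at h
  have h2 := aug_eq_zero h
  rw [map_sub, map_smul, map_one, sub_eq_zero, smul_eq_mul, mul_one] at h2
  rw [h2, Algebra.algebraMap_eq_smul_one]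
  exact h

theorem augSq_coprod (a : KX k G) :
    augSq (aug k G) (fun _ h => aug_eq_zero h) (coprodX k a) = aug k G a := by
  obtain ⟨N, hN⟩ := contSq_coprodX k (G := G) 1
  refine DFunLike.congr_fun (linearMap_ext
    (f := ((augSq (aug k G) (fun _ h => aug_eq_zero h)).comp
    (coprodX k)).toLinearMap) (g := (aug k G).toLinearMap) (max N 1) (fun a ha => ?_)
    (fun a ha => aug_eq_zero (anti (k := k) (le_max_right _ _) ha))
    (fun w => hom_ofM_ext (f := (augSq (aug k G) (fun _ h => aug_eq_zero h)).comp (coprodX k))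
      (g := aug k G) (fun b => ?_) w)) a
  · exact augSq_eq_zero _ _ (hN a (anti (k := k) (le_max_left _ _) ha))
  · exact augSq_primitive (coprodX k) _ _ (aug_letter b) (coprodX_letter k b)

theorem GrpLike.aug_val (Ψ : GrpLike k G) : aug k G Ψ.val = 1 := by
  have h : aug k G Ψ.val * aug k G Ψ.val = aug k G Ψ.val :=
    augSq_grouplike (coprodX k) _ _ (augSq_coprod Ψ.val) Ψ.coprod_val
  have h1 : aug k G Ψ.val * aug k G Ψ.inv = 1 := by rw [← map_mul, Ψ.val_inv, map_one]
  calc aug k G Ψ.val = (aug k G Ψ.val * aug k G Ψ.val) * aug k G Ψ.inv := by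
        rw [mul_assoc, h1, mul_one]
    _ = 1 := by rw [h, h1]

theorem GrpLike.aug_inv (Ψ : GrpLike k G) : aug k G Ψ.inv = 1 := by
  have h1 : aug k G Ψ.val * aug k G Ψ.inv = 1 := by rw [← map_mul, Ψ.val_inv, map_one]
  rwa [Ψ.aug_val, one_mul] at h1

theorem sub_one_mem {a : KX k G} (h : aug k G a = 1) : a - 1 ∈ (fil k 1 : Ideal (KX k G)) := by
  have := sub_aug_mem a
  rwa [h, map_one] at this

theorem aut_unipotent (Ψ : GrpLike k G) (n : ℕ) (a : KX k G)
    (ha : a ∈ (fil k n : Ideal (KX k G))) : aut Ψ a - a ∈ (fil k (n + 1) : Ideal (KX k G)) := by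
  refine unipotent_of_letters (aut Ψ) (isFiltered_aut Ψ) (fun b => ?_) n a ha
  cases b with
  | none =>
    change aut Ψ (x₀ k) - x₀ k ∈ _
    rw [aut_x₀, sub_self]
    exact zero_mem _
  | some g =>
    change aut Ψ (x k g) - x k g ∈ (fil k (1 + 1) : Ideal (KX k G))
    rw [aut_x]
    have h1 : t k g Ψ.inv - 1 ∈ (fil k 1 : Ideal (KX k G)) :=
      sub_one_mem (by rw [aug_t, Ψ.aug_inv])
    have h2 : t k g Ψ.val - 1 ∈ (fil k 1 : Ideal (KX k G)) :=
      sub_one_mem (by rw [aug_t, Ψ.aug_val])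
    have e : t k g Ψ.inv * x k g * t k g Ψ.val - x k g =
        ((t k g Ψ.inv - 1) * x k g) * t k g Ψ.val + x k g * (t k g Ψ.val - 1) := by
      noncomm_ring
    rw [e]
    exact add_mem (Ideal.mul_mem_right _ _ (fil_mul h1 (x_mem k g))) (fil_mul (x_mem k g) h2)

/-- `aut_Ψ` as an automorphism. -/
noncomputable def autEquiv (Ψ : GrpLike k G) : KX k G ≃ₐ[k] KX k G :=
  AlgEquiv.ofBijective (aut Ψ) (unipotent_bijective _ (aut_unipotent Ψ))

theorem aut_autEquiv_symm (Ψ : GrpLike k G) (a : KX k G) :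
    aut Ψ ((autEquiv Ψ).symm a) = a := (autEquiv Ψ).apply_symm_apply a

theorem coprod_autEquiv_symm (Ψ : GrpLike k G) {a : KX k G} (h : coprodX k a = tmul k a a) :
    coprodX k ((autEquiv Ψ).symm a) = tmul k ((autEquiv Ψ).symm a) ((autEquiv Ψ).symm a) := by
  have hf : IsFiltered k ((autEquiv Ψ).symm : KX k G →ₐ[k] KX k G) := fun n c hc =>
    unipotent_mem _ (aut_unipotent Ψ) (by rw [← aut_autEquiv_symm Ψ c] at hc; exact hc)
  refine grouplike_of_map (coprodX k) (aut Ψ) (isFiltered_aut Ψ)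
    ((autEquiv Ψ).symm : KX k G →ₐ[k] KX k G) hf (fun c => (autEquiv Ψ).symm_apply_apply c)
    (coprodX_aut Ψ) ?_
  rw [aut_autEquiv_symm]
  exact h

/-- The inverse of `Ψ` for `⊛` is `aut_Ψ⁻¹(Ψ⁻¹)`. -/
noncomputable instance : Inv (GrpLike k G) where
  inv Ψ :=
    { toUnits := Units.map ((autEquiv Ψ).symm : KX k G →* KX k G) Ψ.toUnits⁻¹
      grouplike := coprod_autEquiv_symm Ψ Ψ.coprod_inv }

/-- The group `(𝒢(k⟨⟨X⟩⟩), ⊛)`. -/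
noncomputable instance : Group (GrpLike k G) :=
  Group.ofRightAxioms
    (fun Ψ Φ Λ => GrpLike.val_injective (by
      simp only [GrpLike.val_mul, aut_mul, map_mul, mul_assoc, AlgHom.comp_apply]))
    (fun Ψ => GrpLike.val_injective (by rw [GrpLike.val_mul, GrpLike.val_one, map_one, mul_one]))
    (fun Ψ => GrpLike.val_injective (by
      rw [GrpLike.val_mul]
      change Ψ.val * aut Ψ ((autEquiv Ψ).symm Ψ.inv) = 1
      rw [aut_autEquiv_symm, Ψ.val_inv]))

end

section

/-- Generators `e₀`, `e₁` and `g ∈ G` of the crossed product. -/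
inductive VGen (G : Type*) where
  | e₀ : VGen G
  | e₁ : VGen G
  | gp (g : G) : VGen G

/-- The relations `g × h = gh`, `1 = 1_G`, `g × e₀ = e₀ × g`. -/
inductive VRel (G : Type*) [CommGroup G] : FreeMonoid (VGen G) → FreeMonoid (VGen G) → Prop where
  | mul (g h : G) : VRel G (FreeMonoid.of (.gp g) * FreeMonoid.of (.gp h))
      (FreeMonoid.of (.gp (g * h)))
  | one : VRel G 1 (FreeMonoid.of (.gp 1))
  | comm (g : G) : VRel G (FreeMonoid.of (.gp g) * FreeMonoid.of .e₀)
      (FreeMonoid.of .e₀ * FreeMonoid.of (.gp g))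

/-- The monoid generated by `e₀`, `e₁` and `G` subject to these relations. -/
abbrev VMon (G : Type*) [CommGroup G] : Type _ := PresentedMonoid (VRel G)

namespace VMon
variable {G : Type*} [CommGroup G]

def e₀ : VMon G := PresentedMonoid.of _ .e₀
def e₁ : VMon G := PresentedMonoid.of _ .e₁
def gp (g : G) : VMon G := PresentedMonoid.of _ (.gp g)

theorem gp_mul (g h : G) : gp g * gp h = gp (g * h) :=
  PresentedMonoid.mk_eq_mk_of_rel (VRel.mul g h)
theorem gp_one : gp (1 : G) = 1 := (PresentedMonoid.mk_eq_mk_of_rel VRel.one).symm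
theorem gp_e₀ (g : G) : gp g * e₀ = e₀ * gp g := PresentedMonoid.mk_eq_mk_of_rel (VRel.comm g)

/-- Induction on a product of generators. -/
theorem induction {p : VMon G → Prop} (one : p 1) (he₀ : ∀ v, p v → p (e₀ * v))
    (he₁ : ∀ v, p v → p (e₁ * v)) (hgp : ∀ g v, p v → p (gp g * v)) (v : VMon G) : p v := by
  obtain ⟨w, rfl⟩ := PresentedMonoid.surjective_mk v
  induction w using FreeMonoid.inductionOn' with
  | one => exact one
  | of_mul a w ih =>
    rw [map_mul]
    cases a with
    | e₀ => exact he₀ _ ih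
    | e₁ => exact he₁ _ ih
    | gp g => exact hgp g _ ih

/-- The morphism of monoids given on generators. -/
def lift {N : Type*} [Monoid N] (a b : N) (c : G →* N) (h : ∀ g, c g * a = a * c g) :
    VMon G →* N :=
  PresentedMonoid.lift (fun | .e₀ => a | .e₁ => b | .gp g => c g) fun x y hxy => by
    cases hxy with
    | mul g h => simp
    | one => simp
    | comm g => simp [h]

section
variable {N : Type*} [Monoid N] (a b : N) (c : G →* N) (h : ∀ g, c g * a = a * c g)

theorem lift_e₀ : lift a b c h e₀ = a := PresentedMonoid.lift_of _ _
theorem lift_e₁ : lift a b c h e₁ = b := PresentedMonoid.lift_of _ _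
theorem lift_gp (g : G) : lift a b c h (gp g) = c g := PresentedMonoid.lift_of _ _

end

/-- The degree: `e₀` and `e₁` have degree one and `g ∈ G` has degree zero. -/
def degHom : VMon G →* Multiplicative ℕ :=
  lift (Multiplicative.ofAdd 1) (Multiplicative.ofAdd 1) 1 fun _ => by simp

def degree (v : VMon G) : ℕ := Multiplicative.toAdd (degHom v)

theorem degree_mul (v w : VMon G) : degree (v * w) = degree v + degree w := by
  simp [degree]
theorem degree_e₀ : degree (e₀ : VMon G) = 1 := by simp [degree, degHom, lift_e₀]
theorem degree_e₁ : degree (e₁ : VMon G) = 1 := by simp [degree, degHom, lift_e₁]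
theorem degree_gp (g : G) : degree (gp g) = 0 := by simp [degree, degHom, lift_gp]

theorem exists_eq (v : VMon G) :
    (∃ g, v = gp g) ∨ (∃ w, v = e₀ * w) ∨ ∃ g w, v = gp g * (e₁ * w) := by
  induction v using induction with
  | one => exact Or.inl ⟨1, gp_one.symm⟩
  | he₀ v ih => exact Or.inr (Or.inl ⟨v, rfl⟩)
  | he₁ v ih => exact Or.inr (Or.inr ⟨1, v, by rw [gp_one, one_mul]⟩)
  | hgp g v ih =>
    rcases ih with ⟨h, rfl⟩ | ⟨w, rfl⟩ | ⟨h, w, rfl⟩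
    · exact Or.inl ⟨g * h, gp_mul g h⟩
    · exact Or.inr (Or.inl ⟨gp g * w, by rw [← mul_assoc, gp_e₀, mul_assoc]⟩)
    · exact Or.inr (Or.inr ⟨g * h, w, by rw [← mul_assoc, gp_mul]⟩)

theorem finite_degree [Finite G] (n : ℕ) : {v : VMon G | degree v ≤ n}.Finite := by
  induction n with
  | zero =>
    refine (Set.finite_range (gp (G := G))).subset fun v hv => ?_
    have hv' : degree v ≤ 0 := hv
    rcases exists_eq v with ⟨g, rfl⟩ | ⟨w, rfl⟩ | ⟨g, w, rfl⟩
    · exact ⟨g, rfl⟩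
    · rw [degree_mul, degree_e₀] at hv'; omega
    · rw [degree_mul, degree_mul, degree_e₁] at hv'; omega
  | succ n ih =>
    refine ((Set.finite_range (gp (G := G))).union ((ih.image fun v => e₀ * v).union
      ((Set.finite_univ.prod ih).image fun p : G × VMon G => gp p.1 * (e₁ * p.2)))).subset
        fun v hv => ?_
    have hv' : degree v ≤ n + 1 := hv
    rcases exists_eq v with ⟨g, rfl⟩ | ⟨w, rfl⟩ | ⟨g, w, rfl⟩
    · exact Or.inl ⟨g, rfl⟩
    · rw [degree_mul, degree_e₀] at hv'
      exact Or.inr (Or.inl ⟨w, by change degree w ≤ n; omega, rfl⟩)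
    · rw [degree_mul, degree_mul, degree_e₁, degree_gp] at hv'
      exact Or.inr (Or.inr ⟨(g, w), ⟨trivial, by change degree w ≤ n; omega⟩, rfl⟩)

instance [Finite G] : WeightedMonoid (VMon G) where
  toMonoid := inferInstance
  wt := degree
  wt_mul := degree_mul
  finite_wt := finite_degree

end VMon

/-- The complete graded algebra `V̂_G` generated by `e₀`, `e₁` of degree one and `g ∈ G` of degree
zero, with relations `g × h = gh`, `1 = 1_G`, `g × e₀ = e₀ × g`. -/
abbrev VHat (k G : Type*) [CommGroup G] : Type _ := Series k (VMon G)

variable (k : Type*) [CommRing k] {G : Type*} [CommGroup G] [Fintype G]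

noncomputable def e₀ : VHat k G := ofM k _ VMon.e₀
noncomputable def e₁ : VHat k G := ofM k _ VMon.e₁
noncomputable def gp : G →* VHat k G :=
  (ofM k _).comp ⟨⟨VMon.gp, VMon.gp_one⟩, fun g h => (VMon.gp_mul g h).symm⟩

theorem gp_apply (g : G) : gp k g = ofM k _ (VMon.gp g) := rfl
theorem gp_mul_inv (g : G) : gp k g * gp k g⁻¹ = 1 := by rw [← map_mul, mul_inv_cancel, map_one]
theorem gp_inv_mul (g : G) : gp k g⁻¹ * gp k g = 1 := by rw [← map_mul, inv_mul_cancel, map_one]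
theorem gp_e₀ (g : G) : gp k g * e₀ k = e₀ k * gp k g := by
  rw [gp_apply, e₀, ← map_mul, ← map_mul, VMon.gp_e₀]

theorem e₀_mem : e₀ k ∈ (fil k 1 : Ideal (VHat k G)) := by
  have h := ofM_mem_fil (k := k) (VMon.e₀ : VMon G)
  rwa [show wt (VMon.e₀ : VMon G) = 1 from VMon.degree_e₀] at h
theorem e₁_mem : e₁ k ∈ (fil k 1 : Ideal (VHat k G)) := by
  have h := ofM_mem_fil (k := k) (VMon.e₁ : VMon G)
  rwa [show wt (VMon.e₁ : VMon G) = 1 from VMon.degree_e₁] at h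

variable {k}

theorem ofM_ext {B : Type*} [Semiring B] [Algebra k B] {f g : VHat k G →ₐ[k] B}
    (h0 : f (e₀ k) = g (e₀ k)) (h1 : f (e₁ k) = g (e₁ k)) (h : ∀ a, f (gp k a) = g (gp k a))
    (v : VMon G) : f (ofM k _ v) = g (ofM k _ v) := by
  induction v using VMon.induction with
  | one => rw [map_one, map_one, map_one]
  | he₀ v ih => rw [map_mul, map_mul, map_mul, ih]; exact congrArg (· * _) h0
  | he₁ v ih => rw [map_mul, map_mul, map_mul, ih]; exact congrArg (· * _) h1
  | hgp a v ih => rw [map_mul, map_mul, map_mul, ih]; exact congrArg (· * _) (h a)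

theorem v_ext {N : Type*} [WeightedMonoid N] {f g : VHat k G →ₐ[k] Series k N}
    (hf : IsFiltered k f) (hg : IsFiltered k g)
    (h0 : f (e₀ k) = g (e₀ k)) (h1 : f (e₁ k) = g (e₁ k)) (h : ∀ a, f (gp k a) = g (gp k a)) :
    f = g := filtered_ext hf hg (ofM_ext h0 h1 h)

theorem lift_mem {A : Type*} [Ring A] [Algebra k A] [FilteredAlgebra k A] {a b : A} (c : G →* A)
    (h : ∀ g, c g * a = a * c g) (ha : a ∈ (fil k 1 : Ideal A)) (hb : b ∈ (fil k 1 : Ideal A))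
    (v : VMon G) : VMon.lift a b c h v ∈ (fil k (wt v) : Ideal A) := by
  induction v using VMon.induction with
  | one => rw [wt_one, fil_zero]; trivial
  | he₀ v ih =>
    rw [map_mul, VMon.lift_e₀, wt_mul, show wt (VMon.e₀ : VMon G) = 1 from VMon.degree_e₀]
    exact fil_mul ha ih
  | he₁ v ih =>
    rw [map_mul, VMon.lift_e₁, wt_mul, show wt (VMon.e₁ : VMon G) = 1 from VMon.degree_e₁]
    exact fil_mul hb ih
  | hgp g v ih =>
    rw [map_mul, wt_mul, show wt (VMon.gp g) = 0 from VMon.degree_gp g, zero_add]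
    exact Ideal.mul_mem_left _ _ ih

/-- The continuous endomorphism of `V̂_G` with `e₀ ↦ e₀`, `e₁ ↦ b`, `g ↦ g`. -/
noncomputable def liftE₁ (b : VHat k G) (hb : b ∈ (fil k 1 : Ideal (VHat k G))) :
    VHat k G →ₐ[k] VHat k G :=
  Series.lift (VMon.lift (e₀ k) b (gp k) (gp_e₀ k)) (lift_mem (gp k) (gp_e₀ k) (e₀_mem k) hb)

section
variable (b : VHat k G) (hb : b ∈ (fil k 1 : Ideal (VHat k G)))

theorem isFiltered_liftE₁ : IsFiltered k (liftE₁ b hb) := isFiltered_lift _ _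
theorem liftE₁_e₀ : liftE₁ b hb (e₀ k) = e₀ k := 
  (lift_ofM _ _ _).trans (VMon.lift_e₀ _ _ _ _)
theorem liftE₁_e₁ : liftE₁ b hb (e₁ k) = b := 
  (lift_ofM _ _ _).trans (VMon.lift_e₁ _ _ _ _)
theorem liftE₁_gp (g : G) : liftE₁ b hb (gp k g) = gp k g := 
  (lift_ofM _ _ _).trans (VMon.lift_gp _ _ _ _ _)

end

variable (k) in
/-- The continuous algebra morphism `k⟨⟨X⟩⟩ → V̂_G, f ↦ β(f ⊗ 1)`, given by `x₀ ↦ e₀`,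
`x_g ↦ -g e₁ g⁻¹`. -/
noncomputable def beta : KX k G →ₐ[k] VHat k G :=
  liftFree (fun | none => e₀ k | some g => -(gp k g * e₁ k * gp k g⁻¹))
    (fun | none => e₀_mem k | some _ => neg_mem (conj_mem (e₁_mem k)))

theorem isFiltered_beta : IsFiltered k (beta k (G := G)) := isFiltered_liftFree _ _
theorem beta_x₀ : beta k (x₀ k : KX k G) = e₀ k := liftFree_letter _ _ _
theorem beta_x (g : G) : beta k (x k g) = -(gp k g * e₁ k * gp k g⁻¹) := liftFree_letter _ _ _

/-- The group element `g` as a unit. -/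
noncomputable def gpU (g : G) : (VHat k G)ˣ := ⟨gp k g, gp k g⁻¹, gp_mul_inv k g, gp_inv_mul k g⟩

theorem beta_t (g : G) (a : KX k G) : beta k (t k g a) = gp k g * beta k a * gp k g⁻¹ := by
  have h : (beta k).comp (t k g) = (Ad k (gpU g)).comp (beta k) := by
    refine kx_ext k (isFiltered_beta.comp (isFiltered_t k g))
      ((isFiltered_Ad _).comp isFiltered_beta) ?_ fun h => ?_
    · change beta k (t k g (x₀ k)) = gp k g * beta k (x₀ k) * gp k g⁻¹
      rw [t_x₀, beta_x₀, gp_e₀, mul_assoc, gp_mul_inv, mul_one]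
    · change beta k (t k g (x k h)) = gp k g * beta k (x k h) * gp k g⁻¹
      rw [t_x, beta_x, beta_x, map_mul, mul_inv, mul_comm g⁻¹, map_mul]
      noncomm_ring
  exact DFunLike.congr_fun h a

/-- The continuous algebra automorphism `aut^{V,(0)}_Ψ` of `V̂_G`, given by `e₀ ↦ e₀`,
`e₁ ↦ β(Ψ⁻¹ ⊗ 1) e₁ β(Ψ ⊗ 1)`, `g ↦ g`. -/
noncomputable def aut₀ (Ψ : GrpLike k G) : VHat k G →ₐ[k] VHat k G :=
  liftE₁ (beta k Ψ.inv * e₁ k * beta k Ψ.val) (conj_mem (e₁_mem k))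

theorem isFiltered_aut₀ (Ψ : GrpLike k G) : IsFiltered k (aut₀ Ψ) := isFiltered_liftE₁ _ _
theorem aut₀_e₀ (Ψ : GrpLike k G) : aut₀ Ψ (e₀ k) = e₀ k := liftE₁_e₀ _ _
theorem aut₀_e₁ (Ψ : GrpLike k G) :
    aut₀ Ψ (e₁ k) = beta k Ψ.inv * e₁ k * beta k Ψ.val := liftE₁_e₁ _ _
theorem aut₀_gp (Ψ : GrpLike k G) (g : G) : aut₀ Ψ (gp k g) = gp k g := liftE₁_gp _ _ _

theorem beta_aut (Ψ : GrpLike k G) (a : KX k G) : beta k (aut Ψ a) = aut₀ Ψ (beta k a) := by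
  have h : (beta k).comp (aut Ψ) = (aut₀ Ψ).comp (beta k) := by
    refine kx_ext k (isFiltered_beta.comp (isFiltered_aut Ψ))
      ((isFiltered_aut₀ Ψ).comp isFiltered_beta) ?_ fun h => ?_
    · rw [AlgHom.comp_apply, AlgHom.comp_apply, aut_x₀, beta_x₀, aut₀_e₀]
    · rw [AlgHom.comp_apply, AlgHom.comp_apply, aut_x, map_mul, map_mul, beta_x, beta_t, beta_t,
        map_neg, map_mul, map_mul, aut₀_gp, aut₀_gp, aut₀_e₁]
      have e := gp_inv_mul k h
      calc _ = -(gp k h * beta k Ψ.inv * (gp k h⁻¹ * gp k h) * e₁ k * (gp k h⁻¹ * gp k h) *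
            beta k Ψ.val * gp k h⁻¹) := by noncomm_ring
        _ = _ := by rw [e]; noncomm_ring
  exact DFunLike.congr_fun h a

theorem aut₀_mul (Ψ Φ : GrpLike k G) : aut₀ (Ψ * Φ) = (aut₀ Ψ).comp (aut₀ Φ) := by
  refine v_ext (isFiltered_aut₀ _) ((isFiltered_aut₀ Ψ).comp (isFiltered_aut₀ Φ)) ?_ ?_ fun g => ?_
  · rw [AlgHom.comp_apply, aut₀_e₀, aut₀_e₀, aut₀_e₀]
  · rw [AlgHom.comp_apply, aut₀_e₁, aut₀_e₁, GrpLike.val_mul, GrpLike.inv_mul, map_mul, map_mul,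
      map_mul, map_mul, beta_aut, beta_aut, aut₀_e₁]
    noncomm_ring
  · rw [AlgHom.comp_apply, aut₀_gp, aut₀_gp, aut₀_gp]

theorem aut₀_one : aut₀ (1 : GrpLike k G) = AlgHom.id k _ := by
  refine v_ext (isFiltered_aut₀ _) IsFiltered.id ?_ ?_ fun g => ?_
  · exact aut₀_e₀ 1
  · rw [aut₀_e₁, GrpLike.val_one, GrpLike.inv_one, map_one, one_mul, mul_one]; rfl
  · exact aut₀_gp 1 g

/-- The unit `β(Ψ ⊗ 1)`. -/
noncomputable def betaU (Ψ : GrpLike k G) : (VHat k G)ˣ :=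
  Units.map (beta k (G := G)).toMonoidHom Ψ.toUnits

theorem betaU_val (Ψ : GrpLike k G) : ((betaU Ψ : (VHat k G)ˣ) : VHat k G) = beta k Ψ.val := rfl
theorem betaU_inv (Ψ : GrpLike k G) :
    (((betaU Ψ)⁻¹ : (VHat k G)ˣ) : VHat k G) = beta k Ψ.inv := rfl

theorem betaU_mul (Ψ Φ : GrpLike k G) :
    betaU (Ψ * Φ) = betaU Ψ * Units.map (aut₀ Ψ : VHat k G →* VHat k G) (betaU Φ) := by
  refine Units.ext ?_
  change beta k (Ψ.val * aut Ψ Φ.val) = beta k Ψ.val * aut₀ Ψ (beta k Φ.val)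
  rw [map_mul, beta_aut]

theorem betaU_one : betaU (1 : GrpLike k G) = 1 := Units.ext (map_one (beta k))

/-- The algebra automorphism `aut^{V,(1)}_Ψ = Ad_{β(Ψ ⊗ 1)} ∘ aut^{V,(0)}_Ψ` of `V̂_G`. -/
noncomputable def aut₁ (Ψ : GrpLike k G) : VHat k G →ₐ[k] VHat k G :=
  (Ad k (betaU Ψ)).comp (aut₀ Ψ)

theorem isFiltered_aut₁ (Ψ : GrpLike k G) : IsFiltered k (aut₁ Ψ) :=
  (isFiltered_Ad _).comp (isFiltered_aut₀ Ψ)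

theorem aut₁_e₁ (Ψ : GrpLike k G) : aut₁ Ψ (e₁ k) = e₁ k := by
  rw [aut₁, AlgHom.comp_apply, Ad_apply, aut₀_e₁, betaU_val, betaU_inv]
  have h : beta k Ψ.val * beta k Ψ.inv = 1 := by rw [← map_mul, Ψ.val_inv, map_one]
  calc _ = (beta k Ψ.val * beta k Ψ.inv) * e₁ k * (beta k Ψ.val * beta k Ψ.inv) := by noncomm_ring
    _ = e₁ k := by rw [h, one_mul, mul_one]

theorem aut₁_mul (Ψ Φ : GrpLike k G) : aut₁ (Ψ * Φ) = (aut₁ Ψ).comp (aut₁ Φ) := by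
  rw [aut₁, aut₁, aut₁, betaU_mul, Ad_mul, aut₀_mul, AlgHom.comp_assoc, AlgHom.comp_assoc,
    ← AlgHom.comp_assoc (aut₀ Ψ), comp_Ad, AlgHom.comp_assoc]

theorem aut₁_one : aut₁ (1 : GrpLike k G) = AlgHom.id k _ := by
  rw [aut₁, betaU_one, aut₀_one, AlgHom.comp_id]
  ext a
  simp [Ad_apply]

end

section

section exponential

variable {k : Type*} [CommRing k] [Algebra ℚ k]

/-- `exp(s)` for a power series `s` without constant term. -/
noncomputable def expSeries (s : PowerSeries k) : PowerSeries k := (PowerSeries.exp k).subst s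

theorem expSeries_zero : expSeries (0 : PowerSeries k) = 1 := by
  rw [expSeries, PowerSeries.subst_zero_eq_C_constantCoeff, PowerSeries.constantCoeff_exp]
  exact map_one _

theorem derivative_expSeries {s : PowerSeries k} (hs : s.constantCoeff = 0) :
    PowerSeries.derivative k (expSeries s) = expSeries s * PowerSeries.derivative k s := by
  rw [expSeries, PowerSeries.derivative_subst (PowerSeries.HasSubst.of_constantCoeff_zero' hs),
    PowerSeries.derivative_exp]

theorem constantCoeff_expSeries {s : PowerSeries k} (hs : s.constantCoeff = 0) :
    (expSeries s).constantCoeff = 1 := by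
  have h : PowerSeries.exp k = (PowerSeries.exp k - PowerSeries.C 1) + PowerSeries.C 1 := by ring
  have h1 : (PowerSeries.exp k - PowerSeries.C 1).constantCoeff = 0 := by
    simp
  rw [expSeries, h, PowerSeries.subst_add (PowerSeries.HasSubst.of_constantCoeff_zero' hs),
    map_add, PowerSeries.subst_C]
  have h2 := PowerSeries.constantCoeff_subst_eq_zero hs _ h1
  have h3 : PowerSeries.constantCoeff (MvPowerSeries.C 1 : PowerSeries k) = 1 :=
    PowerSeries.constantCoeff_C 1
  refine (congrArg₂ (· + ·) h2 h3).trans (zero_add 1)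

theorem eq_one_of_derivative {f : PowerSeries k} (h : PowerSeries.derivative k f = 0)
    (h0 : f.constantCoeff = 1) : f = 1 := by
  have : IsAddTorsionFree k := IsAddTorsionFree.of_module_rat k
  exact PowerSeries.derivative.ext (by rw [h, PowerSeries.derivative_one]) (by simp [h0])

theorem expSeries_mul_neg {s : PowerSeries k} (hs : s.constantCoeff = 0) :
    expSeries s * expSeries (-s) = 1 := by
  have hs' : (-s).constantCoeff = 0 := by rw [map_neg, hs, neg_zero]
  refine eq_one_of_derivative ?_ ?_
  · rw [Derivation.leibniz, derivative_expSeries hs, derivative_expSeries hs', map_neg,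
      smul_eq_mul, smul_eq_mul]
    ring
  · rw [map_mul, constantCoeff_expSeries hs, constantCoeff_expSeries hs', one_mul]

theorem expSeries_add {s u : PowerSeries k} (hs : s.constantCoeff = 0)
    (hu : u.constantCoeff = 0) : expSeries (s + u) = expSeries s * expSeries u := by
  have hs' : (-s).constantCoeff = 0 := by rw [map_neg, hs, neg_zero]
  have hu' : (-u).constantCoeff = 0 := by rw [map_neg, hu, neg_zero]
  have hsu : (s + u).constantCoeff = 0 := by rw [map_add, hs, hu, add_zero]
  have h : expSeries (s + u) * (expSeries (-s) * expSeries (-u)) = 1 := by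
    refine eq_one_of_derivative ?_ ?_
    · rw [Derivation.leibniz, Derivation.leibniz, derivative_expSeries hs',
        derivative_expSeries hu', derivative_expSeries hsu]
      simp only [map_neg, map_add, smul_eq_mul]
      ring
    · rw [map_mul, map_mul, constantCoeff_expSeries hs', constantCoeff_expSeries hu',
        constantCoeff_expSeries hsu, one_mul, one_mul]
  calc expSeries (s + u) = expSeries (s + u) * (expSeries s * expSeries (-s)) *
        (expSeries u * expSeries (-u)) := by
        rw [expSeries_mul_neg hs, expSeries_mul_neg hu, mul_one, mul_one]
    _ = expSeries (s + u) * (expSeries (-s) * expSeries (-u)) * (expSeries s * expSeries u) := by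
        ring
    _ = expSeries s * expSeries u := by rw [h, one_mul]

/-- `exp(s)` as a unit. -/
noncomputable def expU (s : PowerSeries k) (hs : s.constantCoeff = 0) : (PowerSeries k)ˣ :=
  ⟨expSeries s, expSeries (-s), expSeries_mul_neg hs, by rw [mul_comm, expSeries_mul_neg hs]⟩

theorem expU_add {s u : PowerSeries k} (hs : s.constantCoeff = 0)
    (hu : u.constantCoeff = 0) (hsu : (s + u).constantCoeff = 0) :
    expU (s + u) hsu = expU s hs * expU u hu := Units.ext (expSeries_add hs hu)

end exponential

section evaluation

instance : WeightedMonoid (Multiplicative ℕ) where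
  toMonoid := inferInstance
  wt n := n.toAdd
  wt_mul _ _ := rfl
  finite_wt n := (Set.finite_Iic n).preimage Multiplicative.toAdd.injective.injOn

variable {k : Type*} [CommRing k]

/-- A power series in one variable as a formal series over the free monoid on one generator. -/
noncomputable def psFun (f : PowerSeries k) : Series k (Multiplicative ℕ) :=
  fun m => PowerSeries.coeff m.toAdd f

theorem coeff_psFun (f : PowerSeries k) (m : Multiplicative ℕ) :
    (psFun f).coeff m = PowerSeries.coeff m.toAdd f := rfl

theorem psFun_mul (f g : PowerSeries k) : psFun (f * g) = psFun f * psFun g := by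
  ext m
  have h : (psFun f * psFun g).coeff m = ∑ a ∈ ball (Multiplicative ℕ) (wt m),
      ∑ b ∈ ball (Multiplicative ℕ) (wt m),
        if a * b = m then (psFun f).coeff a * (psFun g).coeff b else 0 := by
    rw [coeff_mul_def]
    refine Finset.sum_congr rfl fun a _ => Finset.sum_congr rfl fun b _ => ?_
    split_ifs <;> rfl
  rw [h, coeff_psFun, PowerSeries.coeff_mul, ← Finset.sum_product', ← Finset.sum_filter]
  refine Finset.sum_bij' (fun p _ => (Multiplicative.ofAdd p.1, Multiplicative.ofAdd p.2))
    (fun p _ => (p.1.toAdd, p.2.toAdd)) ?_ ?_ ?_ ?_ ?_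
  · intro p hp
    have hp := Finset.HasAntidiagonal.mem_antidiagonal.1 hp
    rw [Finset.mem_filter]
    refine ⟨Finset.mem_product.2 ⟨mem_ball.2 ?_, mem_ball.2 ?_⟩, ?_⟩
    · change p.1 ≤ m.toAdd; omega
    · change p.2 ≤ m.toAdd; omega
    · exact hp
  · intro p hp
    rw [Finset.mem_filter] at hp
    exact Finset.HasAntidiagonal.mem_antidiagonal.2 hp.2
  · intro p _; rfl
  · intro p _; rfl
  · intro p _; rfl

theorem psFun_one : psFun (1 : PowerSeries k) = 1 := by
  classical
  ext m
  rw [coeff_psFun, PowerSeries.coeff_one, one_def, coeff_single]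
  congr 1

variable (k) in
/-- The algebra morphism `f ↦ psFun f`. -/
noncomputable def ofPowerSeries : PowerSeries k →ₐ[k] Series k (Multiplicative ℕ) :=
  AlgHom.ofLinearMap
    { toFun := psFun
      map_add' := fun f g => by ext m; simp [coeff_psFun]
      map_smul' := fun r f => by ext m; simp [coeff_psFun] }
    psFun_one psFun_mul

theorem powers_mem {A : Type*} [Ring A] [Algebra k A] [FilteredAlgebra k A] {c : A}
    (hc : c ∈ (fil k 1 : Ideal A)) (m : Multiplicative ℕ) :
    powersHom A c m ∈ (fil k (wt m) : Ideal A) := by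
  change c ^ m.toAdd ∈ (fil k m.toAdd : Ideal A)
  induction m.toAdd with
  | zero => rw [fil_zero]; trivial
  | succ n ih => rw [pow_succ]; exact fil_mul ih hc

/-- The evaluation `f ↦ f(c) = ∑ n, (f | xⁿ) cⁿ` of a power series at an element `c` without
constant term. -/
noncomputable def evalAt {N : Type*} [WeightedMonoid N] (c : Series k N)
    (hc : c ∈ (fil k 1 : Ideal (Series k N))) : PowerSeries k →ₐ[k] Series k N :=
  (lift (powersHom _ c) (powers_mem hc)).comp (ofPowerSeries k)

theorem map_evalAt {N : Type*} [WeightedMonoid N] {c : Series k N}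
    (hc : c ∈ (fil k 1 : Ideal (Series k N))) {f : Series k N →ₐ[k] Series k N}
    (hf : IsFiltered k f) (h : f c = c) (s : PowerSeries k) : f (evalAt c hc s) = evalAt c hc s := by
  have e : f.comp (lift (powersHom _ c) (powers_mem hc)) =
      lift (powersHom _ c) (powers_mem hc) := by
    refine filtered_ext (hf.comp (isFiltered_lift _ _)) (isFiltered_lift _ _) fun m => ?_
    rw [AlgHom.comp_apply, lift_ofM, powersHom_apply, map_pow, h]
  exact DFunLike.congr_fun e (ofPowerSeries k s)

end evaluation

end

section

variable {k : Type*} [CommRing k] {G : Type*} [CommGroup G] [Fintype G]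

/-- The word `x₀ʲ x₁`. -/
def wordX (G : Type*) [CommGroup G] (j : ℕ) : FreeMonoid (Option G) :=
  FreeMonoid.of none ^ j * FreeMonoid.of (some 1)

section matrix

open Classical in
/-- The matrices `x₀ ↦ X E₁₁`, `x₁ ↦ E₁₂`, `x_g ↦ 0`. -/
noncomputable def matL (k : Type*) [CommRing k] {G : Type*} [CommGroup G] (a : Option G) :
    Matrix (Fin 2) (Fin 2) (PowerSeries k) :=
  match a with
  | none => !![PowerSeries.X, 0; 0, 0]
  | some g => if g = 1 then !![0, 1; 0, 0] else 0

open Classical in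
theorem lift_matL (w : FreeMonoid (Option G)) :
    (∀ i, PowerSeries.coeff i (FreeMonoid.lift (matL k) w 0 0) =
      if w = FreeMonoid.of none ^ i then 1 else 0) ∧
    (∀ i, PowerSeries.coeff i (FreeMonoid.lift (matL k) w 0 1) =
      if w = wordX G i then 1 else 0) ∧
    FreeMonoid.lift (matL k) w 1 0 = 0 ∧
    FreeMonoid.lift (matL k) w 1 1 = if w = 1 then 1 else 0 := by
  have hne : ∀ (a : Option G) (w : FreeMonoid (Option G)), FreeMonoid.of a * w ≠ 1 := by
    intro a w h
    exact List.cons_ne_nil _ _ h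
  have hcons : ∀ (a b : Option G) (w v : FreeMonoid (Option G)),
      FreeMonoid.of a * w = FreeMonoid.of b * v ↔ a = b ∧ w = v := by
    intro a b w v
    exact List.cons_eq_cons
  induction w using FreeMonoid.inductionOn' with
  | one =>
    rw [map_one]
    refine ⟨fun i => ?_, fun i => ?_, rfl, ?_⟩
    · change PowerSeries.coeff i (1 : PowerSeries k) = _
      rw [PowerSeries.coeff_one]
      cases i with
      | zero => simp
      | succ i => rw [pow_succ', if_neg (Nat.succ_ne_zero i), if_neg (hne _ _).symm]
    · change PowerSeries.coeff i (0 : PowerSeries k) = _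
      rw [map_zero, if_neg]
      cases i with
      | zero => exact (hne (some 1) 1).symm
      | succ i => rw [wordX, pow_succ', mul_assoc]; exact (hne _ _).symm
    · rw [if_pos rfl]; rfl
  | of_mul a w ih =>
    obtain ⟨h00, h01, h10, h11⟩ := ih
    rw [map_mul, FreeMonoid.lift_eval_of]
    set B := FreeMonoid.lift (matL k) w
    cases a with
    | none =>
      have e : ∀ i j, (matL k (none : Option G) * B) i j =
          if i = 0 then PowerSeries.X * B 0 j else 0 := by
        intro i j
        rw [Matrix.mul_apply, Fin.sum_univ_two]
        fin_cases i <;> simp [matL]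
      simp only [e, if_true, if_neg (hne _ _)]
      refine ⟨fun i => ?_, fun i => ?_, by simp, by simp⟩
      · cases i with
        | zero => simp [hne]
        | succ i => simp [PowerSeries.coeff_succ_X_mul, h00, pow_succ', hcons]
      · cases i with
        | zero => 
          have : FreeMonoid.of (none : Option G) * w ≠ wordX G 0 := by
            intro h
            rw [wordX, pow_zero, one_mul, ← mul_one (FreeMonoid.of (some 1)), hcons] at h
            exact Option.some_ne_none _ h.1.symm
          rw [if_neg this]; simp
        | succ i =>
          have : FreeMonoid.of (none : Option G) * w = wordX G (i + 1) ↔ w = wordX G i := by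
            rw [wordX, pow_succ', mul_assoc, hcons, wordX]; simp
          simp only [PowerSeries.coeff_succ_X_mul, h01, this]
    | some g =>
      have n00 : ∀ i, FreeMonoid.of (some g) * w ≠ FreeMonoid.of none ^ i := by
        intro i h
        cases i with
        | zero => exact hne _ _ h
        | succ i =>
          rw [pow_succ', hcons] at h
          exact Option.some_ne_none _ h.1
      have n01 : ∀ i, FreeMonoid.of (some g) * w = wordX G i ↔ i = 0 ∧ g = 1 ∧ w = 1 := by
        intro i
        cases i with
        | zero =>
          rw [wordX, pow_zero, one_mul, ← mul_one (FreeMonoid.of (some 1)), hcons]; simp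
        | succ i => rw [wordX, pow_succ', mul_assoc, hcons]; simp
      simp only [n00, n01, hne, if_false]
      by_cases hg : g = 1
      · have e : ∀ i j, (matL k (some g) * B) i j = if i = 0 then B 1 j else 0 := by
          intro i j
          rw [Matrix.mul_apply, Fin.sum_univ_two]
          fin_cases i <;> simp [matL, hg]
        refine ⟨fun i => by simp [e, h10], fun i => ?_, by simp [e], by simp [e]⟩
        rw [e, if_pos rfl, h11]
        by_cases hw : w = 1
        · simp [hw, hg, PowerSeries.coeff_one]
        · simp [hw]
      · simp [matL, hg]

/-- The truncation `k[[X]] / (Xⁿ)`. -/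
abbrev Tr (k : Type*) [CommRing k] (n : ℕ) : Type _ :=
  PowerSeries k ⧸ Ideal.span {(PowerSeries.X ^ n : PowerSeries k)}

noncomputable def matTr (k : Type*) [CommRing k] (n : ℕ) :
    Matrix (Fin 2) (Fin 2) (PowerSeries k) →ₐ[k] Matrix (Fin 2) (Fin 2) (Tr k n) :=
  (Ideal.Quotient.mkₐ k (Ideal.span {(PowerSeries.X ^ n : PowerSeries k)})).mapMatrix

theorem mk_eq_iff {n : ℕ} {f g : PowerSeries k} :
    (Ideal.Quotient.mkₐ k (Ideal.span {(PowerSeries.X ^ n : PowerSeries k)})) f =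
      (Ideal.Quotient.mkₐ k (Ideal.span {(PowerSeries.X ^ n : PowerSeries k)})) g ↔
      ∀ i < n, PowerSeries.coeff i f = PowerSeries.coeff i g := by
  change Ideal.Quotient.mk _ f = Ideal.Quotient.mk _ g ↔ _
  rw [Ideal.Quotient.eq, Ideal.mem_span_singleton, PowerSeries.X_pow_dvd_iff]
  simp [sub_eq_zero]

theorem wt_none_pow (i : ℕ) : wt (FreeMonoid.of (none : Option G) ^ i) = i := by
  induction i with
  | zero => rw [pow_zero, wt_one]
  | succ i ih => rw [pow_succ, wt_mul, ih, wt_of]; rfl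

theorem wt_wordX (i : ℕ) : wt (wordX G i) = i + 1 := by
  rw [wordX, wt_mul, wt_none_pow, wt_of]; rfl

theorem matL_eq_zero (n : ℕ) (w : FreeMonoid (Option G)) (h : n + 1 ≤ wt w) :
    ((matTr k n).toMonoidHom.comp (FreeMonoid.lift (matL k))) w = 0 := by
  classical
  obtain ⟨h00, h01, h10, h11⟩ := lift_matL (k := k) w
  have z : (0 : Tr k n) = Ideal.Quotient.mkₐ k _ 0 := (map_zero _).symm
  change (matTr k n) (FreeMonoid.lift (matL k) w) = 0
  ext i j
  change Ideal.Quotient.mkₐ k _ (FreeMonoid.lift (matL k) w i j) = 0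
  rw [z, mk_eq_iff]
  intro l hl
  fin_cases i <;> fin_cases j
  · refine (h00 l).trans (if_neg ?_)
    rintro rfl
    rw [wt_none_pow] at h; omega
  · refine (h01 l).trans (if_neg ?_)
    rintro rfl
    rw [wt_wordX] at h; omega
  · exact congrArg _ h10
  · refine congrArg _ (h11.trans (if_neg ?_))
    rintro rfl
    rw [wt_one] at h; omega

/-- The resulting representation on matrices with truncated coefficients. -/
noncomputable def rep (k : Type*) [CommRing k] (G : Type*) [CommGroup G] [Fintype G] (n : ℕ) :
    KX k G →ₐ[k] Matrix (Fin 2) (Fin 2) (Tr k n) :=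
  liftDiscrete ((matTr k n).toMonoidHom.comp (FreeMonoid.lift (matL k))) (n + 1) (matL_eq_zero n)

theorem rep_apply (n : ℕ) (f : KX k G) (i j : Fin 2) : rep k G n f i j =
    Ideal.Quotient.mkₐ k _ (∑ w ∈ ball (FreeMonoid (Option G)) (n + 1),
      f.coeff w • FreeMonoid.lift (matL k) w i j) := by
  rw [rep, liftDiscrete_apply, Matrix.sum_apply, map_sum]
  refine Finset.sum_congr rfl fun w _ => ?_
  rw [map_smul]; rfl

theorem rep_01 (n : ℕ) (f g : KX k G) (h : rep k G n f 0 1 = rep k G n g 0 1) (j : ℕ) (hj : j < n) :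
    f.coeff (wordX G j) = g.coeff (wordX G j) := by
  classical
  have key : ∀ f : KX k G, PowerSeries.coeff j (∑ w ∈ ball (FreeMonoid (Option G)) (n + 1),
      f.coeff w • FreeMonoid.lift (matL k) w 0 1) = f.coeff (wordX G j) := fun f => by
    rw [map_sum]
    simp only [map_smul, (lift_matL (k := k) _).2.1, smul_eq_mul, mul_ite, mul_one, mul_zero]
    rw [Finset.sum_ite_eq', if_pos (mem_ball.2 (by rw [wt_wordX]; omega))]
  rw [rep_apply, rep_apply, mk_eq_iff] at h
  rw [← key f, ← key g, h j hj]

theorem rep_10 (n : ℕ) (f : KX k G) : rep k G n f 1 0 = 0 := by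
  classical
  rw [rep_apply, Finset.sum_eq_zero fun w _ => by rw [(lift_matL (k := k) w).2.2.1, smul_zero],
    map_zero]

theorem rep_11 (n : ℕ) (f : KX k G) (hf : f.coeff 1 = 1) : rep k G n f 1 1 = 1 := by
  classical
  rw [rep_apply, Finset.sum_eq_single_of_mem 1 (mem_ball.2 (by rw [wt_one]; omega)),
    (lift_matL (k := k) _).2.2.2, if_pos rfl, hf, one_smul, map_one]
  intro w _ hw
  rw [(lift_matL (k := k) w).2.2.2, if_neg hw, smul_zero]

theorem rep_eq_zero {n : ℕ} {f : KX k G} (hf : f ∈ (fil k (n + 1) : Ideal (KX k G))) :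
    rep k G n f = 0 := liftDiscrete_eq_zero _ _ (matL_eq_zero n) hf

theorem rep_x₀ (n : ℕ) : rep k G n (x₀ k) = matTr k n !![PowerSeries.X, 0; 0, 0] :=
  (liftDiscrete_ofM _ _ _ _).trans rfl
theorem rep_x_one (n : ℕ) : rep k G n (x k 1) = matTr k n !![0, 1; 0, 0] :=
  (liftDiscrete_ofM _ _ _ _).trans (congrArg (matTr k n) (if_pos rfl))
theorem rep_x (n : ℕ) (g : G) (hg : g ≠ 1) : rep k G n (x k g) = 0 :=
  (liftDiscrete_ofM _ _ _ _).trans ((congrArg (matTr k n) (if_neg hg)).trans (map_zero _))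

section
variable {R : Type*} [CommRing R] [Algebra k R]

/-- The unit `diag(a₁₁, 1)⁻¹`, for triangular inverse matrices `a`, `b` with `a₂₂ = 1`. -/
def diagU (a b : Matrix (Fin 2) (Fin 2) R) (hab : a * b = 1) (hb : b 1 0 = 0) (_ha : a 1 0 = 0) :
    (Matrix (Fin 2) (Fin 2) R)ˣ :=
  have h : a 0 0 * b 0 0 = 1 := by
    have := congrFun (congrFun hab 0) 0
    rwa [Matrix.mul_apply, Fin.sum_univ_two, hb, mul_zero, add_zero] at this
  ⟨!![b 0 0, 0; 0, 1], !![a 0 0, 0; 0, 1],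
    by ext i j; fin_cases i <;> fin_cases j <;> simp [mul_comm, h],
    by ext i j; fin_cases i <;> fin_cases j <;> simp [h]⟩

variable (a b : Matrix (Fin 2) (Fin 2) R) (hab : a * b = 1) (hb : b 1 0 = 0) (ha : a 1 0 = 0)

theorem Ad_diagU_x₀ (ξ : R) : Ad k (diagU a b hab hb ha) !![ξ, 0; 0, 0] = !![ξ, 0; 0, 0] := by
  have h : a 0 0 * b 0 0 = 1 := by
    have := congrFun (congrFun hab 0) 0
    rwa [Matrix.mul_apply, Fin.sum_univ_two, hb, mul_zero, add_zero] at this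
  change !![b 0 0, 0; 0, 1] * !![ξ, 0; 0, 0] * !![a 0 0, 0; 0, 1] = _
  ext i j
  fin_cases i <;> fin_cases j <;> simp
  linear_combination ξ * h

theorem Ad_diagU_x₁ (ha1 : a 1 1 = 1) : Ad k (diagU a b hab hb ha) !![0, 1; 0, 0] =
    b * !![0, 1; 0, 0] * a := by
  change !![b 0 0, 0; 0, 1] * !![0, 1; 0, 0] * !![a 0 0, 0; 0, 1] = _
  ext i j
  fin_cases i <;> fin_cases j <;>
    simp [Matrix.mul_apply, Fin.sum_univ_two, ha, hb, ha1]

theorem mul_Ad_diagU (c : Matrix (Fin 2) (Fin 2) R) (hc : c 1 1 = 1) :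
    (a * Ad k (diagU a b hab hb ha) c) 0 1 = a 0 1 + c 0 1 := by
  have h : a 0 0 * b 0 0 = 1 := by
    have := congrFun (congrFun hab 0) 0
    rwa [Matrix.mul_apply, Fin.sum_univ_two, hb, mul_zero, add_zero] at this
  change (a * (!![b 0 0, 0; 0, 1] * c * !![a 0 0, 0; 0, 1])) 0 1 = _
  have e := Matrix.eta_fin_two c
  rw [hc] at e
  rw [e]
  simp [Matrix.mul_apply, Fin.sum_univ_two]
  linear_combination c 0 1 * h

end

theorem coeff_one_of_aug {f : KX k G} (h : aug k G f = 1) : f.coeff 1 = 1 := by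
  classical
  have := sub_one_mem h 1 (by rw [wt_one]; exact Nat.one_pos)
  rw [coeff_sub, one_def, coeff_single, if_pos rfl, sub_eq_zero] at this
  exact this

theorem rep_aut (n : ℕ) (Ψ : GrpLike k G) (hab : rep k G n Ψ.val * rep k G n Ψ.inv = 1) :
    (rep k G n).comp (aut Ψ) =
      (Ad k (diagU _ _ hab (rep_10 n _) (rep_10 n _))).comp (rep k G n) := by
  refine AlgHom.ext fun f => DFunLike.congr_fun (linearMap_ext
    (f := ((rep k G n).comp (aut Ψ)).toLinearMap)
    (g := ((Ad k (diagU _ _ hab (rep_10 n _) (rep_10 n _))).comp (rep k G n)).toLinearMap) (n + 1)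
    (fun a ha => rep_eq_zero (isFiltered_aut Ψ _ a ha))
    (fun a ha => (congrArg (Ad k (diagU _ _ hab (rep_10 n _) (rep_10 n _)))
      (rep_eq_zero ha)).trans (map_zero _))
    (fun w => hom_ofM_ext (f := (rep k G n).comp (aut Ψ))
      (g := (Ad k (diagU _ _ hab (rep_10 n _) (rep_10 n _))).comp (rep k G n)) (fun b => ?_) w)) f
  have e0 : matTr k n !![PowerSeries.X, 0; 0, 0] =
      !![(Ideal.Quotient.mkₐ k _ PowerSeries.X : Tr k n), 0; 0, 0] := by
    ext i j; fin_cases i <;> fin_cases j <;> simp [matTr]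
  have e1 : matTr k n !![0, 1; 0, 0] = !![(0 : Tr k n), 1; 0, 0] := by
    ext i j; fin_cases i <;> fin_cases j <;> simp [matTr]
  cases b with
  | none =>
    change rep k G n (aut Ψ (x₀ k)) = Ad k _ (rep k G n (x₀ k))
    rw [aut_x₀, rep_x₀, e0, Ad_diagU_x₀]
  | some g =>
    change rep k G n (aut Ψ (x k g)) = Ad k _ (rep k G n (x k g))
    rw [aut_x, map_mul, map_mul]
    by_cases hg : g = 1
    · subst hg
      rw [t_one, AlgHom.id_apply, AlgHom.id_apply, rep_x_one, e1,
        Ad_diagU_x₁ _ _ _ _ _ (rep_11 n _ (coeff_one_of_aug Ψ.aug_val))]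
    · rw [rep_x n g hg, mul_zero, zero_mul, map_zero]

theorem coeff_mul_wordX (Ψ Φ : GrpLike k G) (j : ℕ) :
    (Ψ * Φ).val.coeff (wordX G j) = Ψ.val.coeff (wordX G j) + Φ.val.coeff (wordX G j) := by
  refine rep_01 (j + 1) (Ψ * Φ).val (Ψ.val + Φ.val) ?_ j (Nat.lt_succ_self j)
  have hab : rep k G (j + 1) Ψ.val * rep k G (j + 1) Ψ.inv = 1 := by
    rw [← map_mul, Ψ.val_inv, map_one]
  rw [GrpLike.val_mul, map_mul, map_add]
  have h := DFunLike.congr_fun (rep_aut (j + 1) Ψ hab) Φ.val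
  rw [AlgHom.comp_apply, AlgHom.comp_apply] at h
  rw [h]
  exact mul_Ad_diagU _ _ _ _ _ _ (rep_11 _ _ (coeff_one_of_aug Φ.aug_val))

end matrix

theorem commute_evalAt {N : Type*} [WeightedMonoid N] {c : Series k N}
    (hc : c ∈ (fil k 1 : Ideal (Series k N))) (s : PowerSeries k) : Commute (evalAt c hc s) c := by
  have h : evalAt c hc PowerSeries.X = c := by
    have e : ofPowerSeries k PowerSeries.X = ofM k _ (Multiplicative.ofAdd 1) := by
      classical
      ext m
      rw [coeff_ofM]
      change PowerSeries.coeff m.toAdd PowerSeries.X = _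
      rw [PowerSeries.coeff_X]
      rfl
    rw [evalAt, AlgHom.comp_apply, e, lift_ofM, powersHom_apply]
    exact pow_one c
  nth_rewrite 2 [← h]
  exact (Commute.all s PowerSeries.X).map (evalAt c hc)

section gamma
variable [Algebra ℚ k]

/-- `∑_{n ≥ 2} ((-1)ⁿ⁻¹ / n) (Ψ | x₀ⁿ⁻¹ x₁) xⁿ`. -/
noncomputable def logGamma (Ψ : GrpLike k G) : PowerSeries k :=
  PowerSeries.mk fun n =>
    if 2 ≤ n then ((-1) ^ (n - 1) / (n : ℚ)) • Ψ.val.coeff (wordX G (n - 1)) else 0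

theorem constantCoeff_logGamma (Ψ : GrpLike k G) : (logGamma Ψ).constantCoeff = 0 := by
  rw [← PowerSeries.coeff_zero_eq_constantCoeff_apply, logGamma, PowerSeries.coeff_mk]
  rfl

theorem logGamma_mul (Ψ Φ : GrpLike k G) : logGamma (Ψ * Φ) = logGamma Ψ + logGamma Φ := by
  ext n
  rw [map_add, logGamma, logGamma, logGamma, PowerSeries.coeff_mk, PowerSeries.coeff_mk,
    PowerSeries.coeff_mk]
  split_ifs
  · rw [coeff_mul_wordX, smul_add]
  · rw [add_zero]

/-- `Γ_Ψ(x) = exp(∑_{n ≥ 2} ((-1)ⁿ⁻¹ / n) (Ψ | x₀ⁿ⁻¹ x₁) xⁿ)`, an invertible power series. -/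
noncomputable def Gamma (Ψ : GrpLike k G) : (PowerSeries k)ˣ :=
  expU (logGamma Ψ) (constantCoeff_logGamma Ψ)

theorem Gamma_mul (Ψ Φ : GrpLike k G) : Gamma (Ψ * Φ) = Gamma Ψ * Gamma Φ := by
  refine Units.ext ?_
  change expSeries (logGamma (Ψ * Φ)) = expSeries (logGamma Ψ) * expSeries (logGamma Φ)
  rw [logGamma_mul, expSeries_add (constantCoeff_logGamma Ψ) (constantCoeff_logGamma Φ)]

theorem Gamma_one : Gamma (1 : GrpLike k G) = 1 := by
  have := Gamma_mul (1 : GrpLike k G) 1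
  rwa [mul_one, left_eq_mul] at this

/-- The unit `Γ_Ψ⁻¹(-e₁)` of `V̂_G`. -/
noncomputable def gammaU (Ψ : GrpLike k G) : (VHat k G)ˣ :=
  Units.map (evalAt (-e₁ k) (neg_mem (e₁_mem k)) : PowerSeries k →ₐ[k] VHat k G).toMonoidHom
    (Gamma Ψ)⁻¹

theorem gammaU_mul (Ψ Φ : GrpLike k G) : gammaU (Ψ * Φ) = gammaU Ψ * gammaU Φ := by
  rw [gammaU, Gamma_mul, mul_inv, map_mul]; rfl

theorem gammaU_one : gammaU (1 : GrpLike k G) = 1 := by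
  rw [gammaU, Gamma_one, inv_one, map_one]

theorem aut₁_gammaU (Ψ Φ : GrpLike k G) :
    Units.map (aut₁ Ψ : VHat k G →* VHat k G) (gammaU Φ) = gammaU Φ :=
  Units.ext (map_evalAt (neg_mem (e₁_mem k)) (isFiltered_aut₁ Ψ) (by rw [map_neg, aut₁_e₁]) _)

/-- The automorphism `^Γaut^{V,(1)}_Ψ = Ad_{Γ_Ψ⁻¹(-e₁)} ∘ aut^{V,(1)}_Ψ` of `V̂_G`. -/
noncomputable def autΓ (Ψ : GrpLike k G) : VHat k G →ₐ[k] VHat k G :=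
  (Ad k (gammaU Ψ)).comp (aut₁ Ψ)

theorem isFiltered_autΓ (Ψ : GrpLike k G) : IsFiltered k (autΓ Ψ) :=
  (isFiltered_Ad _).comp (isFiltered_aut₁ Ψ)

theorem autΓ_mul (Ψ Φ : GrpLike k G) : autΓ (Ψ * Φ) = (autΓ Ψ).comp (autΓ Φ) := by
  rw [autΓ, autΓ, autΓ, gammaU_mul, Ad_mul, aut₁_mul, AlgHom.comp_assoc, AlgHom.comp_assoc,
    ← AlgHom.comp_assoc (aut₁ Ψ), comp_Ad, AlgHom.comp_assoc, aut₁_gammaU]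

theorem autΓ_one : autΓ (1 : GrpLike k G) = AlgHom.id k _ := by
  rw [autΓ, gammaU_one, aut₁_one, AlgHom.comp_id]
  ext a
  simp [Ad_apply]

theorem autΓ_e₁ (Ψ : GrpLike k G) : autΓ Ψ (e₁ k) = e₁ k := by
  rw [autΓ, AlgHom.comp_apply, aut₁_e₁, Ad_apply]
  have h : Commute ((gammaU Ψ : (VHat k G)ˣ) : VHat k G) (e₁ k) :=
    Commute.neg_right_iff.1 (commute_evalAt (neg_mem (e₁_mem k)) _)
  rw [h.eq, mul_assoc, Units.mul_inv, mul_one]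

end gamma

end

section

variable {k : Type*} [CommRing k] {G : Type*} [CommGroup G] [Fintype G]

variable (k G) in
/-- The subalgebra `Ŵ_G = k ⊕ V̂_G e₁` of `V̂_G`. -/
noncomputable def WHat : Subalgebra k (VHat k G) where
  carrier := {a | ∃ (r : k) (v : VHat k G), a = algebraMap k _ r + v * e₁ k}
  mul_mem' := by
    rintro _ _ ⟨r, v, rfl⟩ ⟨s, w, rfl⟩
    refine ⟨r * s, algebraMap k _ r * w + v * (algebraMap k _ s) + v * e₁ k * w, ?_⟩
    have h : v * e₁ k * algebraMap k _ s = v * algebraMap k _ s * e₁ k := by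
      rw [mul_assoc, mul_assoc, Algebra.commutes]
    rw [map_mul, add_mul, mul_add, mul_add, h]
    noncomm_ring
  add_mem' := by
    rintro _ _ ⟨r, v, rfl⟩ ⟨s, w, rfl⟩
    exact ⟨r + s, v + w, by rw [map_add, add_mul]; abel⟩
  algebraMap_mem' r := ⟨r, 0, by rw [zero_mul, add_zero]⟩

theorem mul_e₁_mem (v : VHat k G) : v * e₁ k ∈ WHat k G := ⟨0, v, by rw [map_zero, zero_add]⟩

section action
variable [Algebra ℚ k]

theorem autΓ_mem (Ψ : GrpLike k G) (a : VHat k G) (ha : a ∈ WHat k G) : autΓ Ψ a ∈ WHat k G := by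
  obtain ⟨r, v, rfl⟩ := ha
  exact ⟨r, autΓ Ψ v, by rw [map_add, map_mul, AlgHom.commutes, autΓ_e₁]⟩

/-- The automorphism `^Γaut^{W,(1)}_Ψ` of `Ŵ_G`, the restriction of `^Γaut^{V,(1)}_Ψ`. -/
noncomputable def autW (Ψ : GrpLike k G) : WHat k G →ₐ[k] WHat k G :=
  ((autΓ Ψ).comp (WHat k G).val).codRestrict (WHat k G) fun a => autΓ_mem Ψ a a.2

theorem coe_autW (Ψ : GrpLike k G) (a : WHat k G) :
    (autW Ψ a : VHat k G) = autΓ Ψ (a : VHat k G) := rfl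

theorem isFiltered_autW (Ψ : GrpLike k G) : IsFiltered k (autW Ψ) := fun n a ha =>
  isFiltered_autΓ Ψ n a ha

variable (k G) in
/-- The action of `(𝒢(k⟨⟨X⟩⟩), ⊛)` on `Ŵ_G` by `Ψ ↦ ^Γaut^{W,(1)}_Ψ`. -/
noncomputable def actW : GrpLike k G →* FEnd k (WHat k G) where
  toFun Ψ := ⟨autW Ψ, isFiltered_autW Ψ⟩
  map_one' := Subtype.ext (AlgHom.ext fun a => Subtype.ext (DFunLike.congr_fun autΓ_one a.1))
  map_mul' Ψ Φ :=
    Subtype.ext (AlgHom.ext fun a => Subtype.ext (DFunLike.congr_fun (autΓ_mul Ψ Φ) a.1))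

end action

/-- The alphabet `Y = {y_{n,g} | n ≥ 1, g ∈ G}`, with `y_{n,g}` of degree `n`. -/
instance : GradedAlphabet (ℕ+ × G) where
  deg p := p.1
  deg_pos p := p.1.pos
  finite_deg n := by
    refine Set.Finite.subset (((Set.finite_Iic n).preimage
      (PNat.coe_injective.injOn)).prod (Set.finite_univ (α := G))) fun p hp => ⟨hp, trivial⟩

/-- The algebra `k⟨⟨Y⟩⟩`. -/
abbrev KY (k G : Type*) : Type _ := Series k (FreeMonoid (ℕ+ × G))

variable (k) in
/-- The letter `y_{n,g}`. -/
noncomputable def y (n : ℕ+) (g : G) : KY k G := letter k (n, g)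

theorem y_mem (n : ℕ+) (g : G) : y k n g ∈ (fil k n : Ideal (KY k G)) := letter_mem_fil (n, g)

variable (k) in
/-- The element `z_{n,g} = -e₀ⁿ⁻¹ g e₁` of `Ŵ_G`. -/
noncomputable def z (n : ℕ+) (g : G) : WHat k G :=
  ⟨-(e₀ k ^ ((n : ℕ) - 1) * gp k g * e₁ k), neg_mem (mul_e₁_mem _)⟩

theorem pow_e₀_mem (n : ℕ) : e₀ k ^ n ∈ (fil k n : Ideal (VHat k G)) := by
  induction n with
  | zero => rw [fil_zero]; trivial
  | succ n ih => rw [pow_succ]; exact fil_mul ih (e₀_mem k)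

theorem z_mem (n : ℕ+) (g : G) : z k n g ∈ (fil k n : Ideal (WHat k G)) := by
  have h := fil_mul (Ideal.mul_mem_right (gp k g) _ (pow_e₀_mem ((n : ℕ) - 1)))
    (e₁_mem k (G := G))
  rw [Nat.sub_add_cancel n.pos] at h
  exact neg_mem (S := Ideal (VHat k G)) h

theorem ϖ_mem (p : ℕ+ × G) :
    (z k p.1 p.2 : VHat k G) ∈ (fil k (deg p) : Ideal (VHat k G)) := z_mem p.1 p.2

variable (k G) in
/-- The continuous algebra morphism `k⟨⟨Y⟩⟩ → V̂_G, y_{n,g} ↦ z_{n,g}`. -/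
noncomputable def ϖV : KY k G →ₐ[k] VHat k G :=
  liftFree (fun p => (z k p.1 p.2 : VHat k G)) ϖ_mem

section words
open VMon

/-- The monomial `e₀ⁿ⁻¹ g e₁`. -/
def zMon (p : ℕ+ × G) : VMon G := VMon.e₀ ^ ((p.1 : ℕ) - 1) * (VMon.gp p.2 * VMon.e₁)

/-- The product of the monomials attached to the letters of a word. -/
def zWord : FreeMonoid (ℕ+ × G) →* VMon G := FreeMonoid.lift zMon

theorem wt_zMon (p : ℕ+ × G) : wt (zMon p) = p.1 := by
  have h : ∀ n : ℕ, degree (VMon.e₀ ^ n : VMon G) = n := by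
    intro n
    induction n with
    | zero => exact wt_one (M := VMon G)
    | succ n ih => rw [pow_succ, degree_mul, ih, degree_e₀]
  change degree _ = _
  rw [zMon, degree_mul, degree_mul, h, degree_gp, degree_e₁, zero_add]
  exact Nat.sub_add_cancel p.1.pos

theorem wt_zWord (w : FreeMonoid (ℕ+ × G)) : wt (zWord w) = wt w := by
  induction w using FreeMonoid.inductionOn' with
  | one => rw [map_one, wt_one, wt_one]
  | of_mul a w ih =>
    rw [map_mul, wt_mul, ih, wt_of_mul, zWord, FreeMonoid.lift_eval_of, wt_zMon]; rfl

/-- The action of the crossed product monoid on words in `x₀, x_g`. -/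
def onLists : VMon G →* Function.End (List (Option G)) :=
  VMon.lift (N := Function.End (List (Option G))) (fun l => none :: l) (fun l => some 1 :: l)
    { toFun := fun g l => l.map (Option.map (g * ·))
      map_one' := by
        funext l
        simp only [one_mul]
        change List.map (Option.map id) l = l
        simp
      map_mul' := fun g h => by
        funext l
        change _ = List.map _ (List.map _ l)
        rw [List.map_map, Option.map_comp_map]
        simp [Function.comp_def, mul_assoc] }
    fun g => rfl

theorem onLists_zMon (p : ℕ+ × G) (l : List (Option G)) : onLists (zMon p) l =
    List.replicate ((p.1 : ℕ) - 1) none ++ some p.2 :: l.map (Option.map (p.2 * ·)) := by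
  have h : ∀ n l, onLists (VMon.e₀ ^ n : VMon G) l = List.replicate n none ++ l := by
    intro n
    induction n with
    | zero => intro l; rw [pow_zero, map_one]; rfl
    | succ n ih =>
      intro l
      rw [pow_succ', map_mul]
      change onLists VMon.e₀ (onLists (VMon.e₀ ^ n) l) = _
      rw [ih]; rfl
  rw [zMon, map_mul, map_mul]
  change onLists (VMon.e₀ ^ ((p.1 : ℕ) - 1)) (onLists (VMon.gp p.2) (onLists VMon.e₁ l)) = _
  rw [h]
  change _ ++ List.map (Option.map (p.2 * ·)) (some 1 :: l) = _
  simp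

theorem replicate_inj (a b : ℕ) (g h : G) (l m : List (Option G))
    (e : List.replicate a none ++ some g :: l = List.replicate b none ++ some h :: m) :
    a = b ∧ g = h ∧ l = m := by
  induction a generalizing b with
  | zero =>
    cases b with
    | zero => simpa using e
    | succ b => simp [List.replicate_succ] at e
  | succ a ih =>
    cases b with
    | zero => simp [List.replicate_succ] at e
    | succ b =>
      simp only [List.replicate_succ, List.cons_append, List.cons.injEq, true_and] at e
      obtain ⟨h1, h2⟩ := ih b e
      exact ⟨by rw [h1], h2⟩

theorem zWord_injective : Function.Injective (zWord (G := G)) := by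
  have key : ∀ w v : FreeMonoid (ℕ+ × G),
      onLists (zWord w) [] = onLists (zWord v) [] → w = v := by
    intro w
    induction w using FreeMonoid.inductionOn' with
    | one =>
      intro v h
      cases v using FreeMonoid.casesOn with
      | one => rfl
      | of_mul p v =>
        rw [map_one, map_one, map_mul, map_mul, zWord, FreeMonoid.lift_eval_of] at h
        change [] = onLists (zMon p) (onLists _ []) at h
        rw [onLists_zMon] at h
        simp at h
    | of_mul q w ih =>
      intro v h
      have hc : ∀ (p : ℕ+ × G) v, onLists (zWord (FreeMonoid.of p * v)) [] =
          List.replicate ((p.1 : ℕ) - 1) none ++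
            some p.2 :: (onLists (zWord v) []).map (Option.map (p.2 * ·)) := by
        intro p v
        rw [map_mul, map_mul, ← onLists_zMon]; rfl
      cases v using FreeMonoid.casesOn with
      | one =>
        rw [hc, map_one, map_one] at h
        change _ = [] at h
        simp at h
      | of_mul p v =>
        rw [hc, hc] at h
        obtain ⟨h1, h2, h3⟩ := replicate_inj _ _ _ _ _ _ h
        have h4 : q = p := Prod.ext (PNat.coe_injective (by
          have := q.1.pos
          have := p.1.pos
          omega)) h2
        subst h4
        rw [ih v (List.map_injective_iff.2 (Option.map_injective (mul_right_injective q.2)) h3)]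
  intro w v h
  exact key w v (by rw [h])

theorem exists_zWord (v : VMon G) : ∃ w, v * VMon.e₁ = zWord w := by
  suffices h : ∃ p w, v * VMon.e₁ = zWord (FreeMonoid.of p * w) by
    obtain ⟨p, w, h⟩ := h
    exact ⟨_, h⟩
  have hz : ∀ (p : ℕ+ × G) w, zWord (FreeMonoid.of p * w) = zMon p * zWord w := fun p w => by
    rw [map_mul]; rfl
  have h1 : zMon ((1 : ℕ+), (1 : G)) = VMon.e₁ := by
    rw [zMon, VMon.gp_one, one_mul, PNat.one_coe, Nat.sub_self, pow_zero, one_mul]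
  induction v using VMon.induction with
  | one => exact ⟨(1, 1), 1, by rw [hz, map_one, h1, one_mul, mul_one]⟩
  | he₀ v ih =>
    obtain ⟨p, w, h⟩ := ih
    refine ⟨(p.1 + 1, p.2), w, ?_⟩
    rw [mul_assoc, h, hz, hz, zMon, zMon, ← mul_assoc, ← mul_assoc, ← pow_succ']
    rw [PNat.add_coe, PNat.one_coe, Nat.add_sub_cancel, Nat.sub_add_cancel p.1.pos]
  | he₁ v ih =>
    obtain ⟨p, w, h⟩ := ih
    refine ⟨(1, 1), FreeMonoid.of p * w, ?_⟩
    rw [mul_assoc, h, hz (1, 1), h1]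
  | hgp g v ih =>
    obtain ⟨p, w, h⟩ := ih
    refine ⟨(p.1, g * p.2), w, ?_⟩
    have hg : ∀ n, VMon.gp g * VMon.e₀ ^ n = VMon.e₀ ^ n * VMon.gp g := fun n =>
      (show Commute (VMon.gp g) VMon.e₀ from VMon.gp_e₀ g).pow_right n
    rw [mul_assoc, h, hz, hz, zMon, zMon, ← mul_assoc, ← mul_assoc, hg, ← VMon.gp_mul]
    simp only [mul_assoc]

theorem zWord_eq (w : FreeMonoid (ℕ+ × G)) : w = 1 ∨ ∃ v, zWord w = v * VMon.e₁ := by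
  induction w using FreeMonoid.inductionOn' with
  | one => exact Or.inl rfl
  | of_mul p w ih =>
    refine Or.inr ?_
    rw [map_mul, zWord, FreeMonoid.lift_eval_of]
    change ∃ v, zMon p * zWord w = _
    rcases ih with rfl | ⟨v, h⟩
    · exact ⟨_, by rw [map_one, mul_one, zMon, ← mul_assoc]⟩
    · exact ⟨zMon p * v, by rw [h, mul_assoc]⟩

end words

end

section

variable {k : Type*} [CommRing k] {G : Type*} [CommGroup G] [Fintype G]

theorem lift_z (w : FreeMonoid (ℕ+ × G)) :
    FreeMonoid.lift (fun p : ℕ+ × G => (z k p.1 p.2 : VHat k G)) w =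
      ((-1 : k) ^ w.length) • ofM k _ (zWord w) := by
  induction w using FreeMonoid.inductionOn' with
  | one => simp
  | of_mul p w ih =>
    have h : (z k p.1 p.2 : VHat k G) = (-1 : k) • ofM k _ (zMon p) := by
      rw [zMon, map_mul, map_mul, map_pow, ← mul_assoc, neg_smul, one_smul]; rfl
    have e : zWord (FreeMonoid.of p * w) = zMon p * zWord w := by rw [map_mul]; rfl
    rw [map_mul, FreeMonoid.lift_eval_of, ih, h, smul_mul_smul_comm, e, map_mul,
      FreeMonoid.length_mul, FreeMonoid.length_of, pow_add, pow_one]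

theorem coeff_ϖV (f : KY k G) (v : VMon G) [DecidableEq (VMon G)] :
    (ϖV k G f).coeff v = ∑ w ∈ ball (FreeMonoid (ℕ+ × G)) (wt v),
      if zWord w = v then (-1) ^ w.length * f.coeff w else 0 := by
  rw [ϖV, liftFree, coeff_lift]
  refine Finset.sum_congr rfl fun w _ => ?_
  rw [lift_z, coeff_smul, coeff_ofM]
  by_cases h : zWord w = v
  · rw [if_pos h, if_pos h.symm, mul_one, mul_comm]
  · rw [if_neg h, if_neg (Ne.symm h), mul_zero, mul_zero]

theorem coeff_ϖV_zWord (f : KY k G) (w : FreeMonoid (ℕ+ × G)) :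
    (ϖV k G f).coeff (zWord w) = (-1) ^ w.length * f.coeff w := by
  classical
  rw [coeff_ϖV, Finset.sum_eq_single_of_mem w (mem_ball.2 (wt_zWord w).ge), if_pos rfl]
  intro b _ hb
  rw [if_neg fun h => hb (zWord_injective h)]

theorem coeff_ϖV_of_not (f : KY k G) (v : VMon G) (hv : ∀ w, zWord w ≠ v) :
    (ϖV k G f).coeff v = 0 := by
  classical
  rw [coeff_ϖV]
  exact Finset.sum_eq_zero fun w _ => if_neg (hv w)

theorem mem_WHat_iff (a : VHat k G) :
    a ∈ WHat k G ↔ ∀ v, (∀ w, zWord w ≠ v) → a.coeff v = 0 := by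
  classical
  constructor
  · rintro ⟨r, b, rfl⟩ v hv
    rw [coeff_add, Algebra.algebraMap_eq_smul_one, coeff_smul, one_def, coeff_single,
      if_neg fun h => hv 1 (by rw [map_one, h]), mul_zero, zero_add]
    change (b * single VMon.e₁ 1).coeff v = 0
    rw [coeff_mul_single _ _ _ _ le_rfl]
    refine Finset.sum_eq_zero fun u _ => if_neg fun h => ?_
    obtain ⟨w, hw⟩ := exists_zWord u
    exact hv w (hw.symm.trans h)
  · intro h
    let σ : VMon G → VMon G := fun v => if h : ∃ u, u * VMon.e₁ = v then h.choose else 1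
    have hσ : ∀ u, σ (u * VMon.e₁) * VMon.e₁ = u * VMon.e₁ := fun u => by
      have h : ∃ u', u' * VMon.e₁ = u * VMon.e₁ := ⟨u, rfl⟩
      change (if h : ∃ u', u' * VMon.e₁ = u * VMon.e₁ then h.choose else 1) * _ = _
      rw [dif_pos h]
      exact h.choose_spec
    let b : VHat k G := fun u => if u = σ (u * VMon.e₁) then a.coeff (u * VMon.e₁) else 0
    have hb : ∀ u, b.coeff u = if u = σ (u * VMon.e₁) then a.coeff (u * VMon.e₁) else 0 :=
      fun u => rfl
    have h1 : ∀ u : VMon G, u * VMon.e₁ ≠ 1 := fun u hu => by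
      have := congrArg VMon.degree hu
      rw [VMon.degree_mul, VMon.degree_e₁] at this
      have h0 : VMon.degree (1 : VMon G) = 0 := wt_one (M := VMon G)
      omega
    refine ⟨a.coeff 1, b, ?_⟩
    ext v
    rw [coeff_add, Algebra.algebraMap_eq_smul_one, coeff_smul, one_def, coeff_single]
    change _ = _ + (b * single VMon.e₁ 1).coeff v
    rw [coeff_mul_single _ _ _ _ le_rfl]
    by_cases hv : ∃ u, u * VMon.e₁ = v
    · obtain ⟨u, rfl⟩ := hv
      rw [if_neg (h1 u), mul_zero, zero_add,
        Finset.sum_eq_single_of_mem (σ (u * VMon.e₁)) (mem_ball.2 ?_), if_pos (hσ u), mul_one, hb,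
        hσ, if_pos rfl]
      · intro c _ hc
        split_ifs with h
        · rw [hb, h, if_neg hc, zero_mul]
        · rfl
      · have := congrArg VMon.degree (hσ u)
        rw [VMon.degree_mul, VMon.degree_mul] at this
        change VMon.degree _ ≤ VMon.degree _
        rw [VMon.degree_mul]; omega
    · rw [Finset.sum_eq_zero fun c _ => if_neg fun h => hv ⟨c, h⟩, add_zero]
      by_cases h2 : v = 1
      · rw [if_pos h2, mul_one, h2]
      · rw [if_neg h2, mul_zero]
        refine h v fun w hw => ?_
        rcases zWord_eq w with rfl | ⟨u, hu⟩
        · exact h2 (hw.symm.trans (map_one _))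
        · exact hv ⟨u, hu.symm.trans hw⟩

variable (k G) in
/-- The algebra morphism `ϖ : k⟨⟨Y⟩⟩ → Ŵ_G`, `y_{n,g} ↦ z_{n,g}`. -/
noncomputable def ϖHom : KY k G →ₐ[k] WHat k G :=
  (ϖV k G).codRestrict (WHat k G) fun f =>
    (mem_WHat_iff _).2 fun v hv => coeff_ϖV_of_not f v hv

theorem ϖHom_y (n : ℕ+) (g : G) : ϖHom k G (y k n g) = z k n g :=
  Subtype.ext (liftFree_letter (fun p : ℕ+ × G => (z k p.1 p.2 : VHat k G)) ϖ_mem (n, g))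

theorem neg_one_pow_mul_self (n : ℕ) (a : k) : (-1) ^ n * ((-1) ^ n * a) = a := by
  rw [← mul_assoc, ← mul_pow, neg_mul_neg, one_mul, one_pow, one_mul]

theorem ϖHom_bijective : Function.Bijective (ϖHom k G) := by
  constructor
  · intro f g h
    ext w
    have h1 : (ϖV k G f).coeff (zWord w) = (ϖV k G g).coeff (zWord w) :=
      congrArg (fun a : WHat k G => (a : VHat k G).coeff (zWord w)) h
    rw [coeff_ϖV_zWord, coeff_ϖV_zWord] at h1
    have h2 := congrArg ((-1) ^ w.length * ·) h1
    simpa only [neg_one_pow_mul_self] using h2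
  · intro a
    let f : KY k G := fun w => (-1) ^ w.length * (a : VHat k G).coeff (zWord w)
    refine ⟨f, Subtype.ext ?_⟩
    change ϖV k G f = (a : VHat k G)
    ext v
    by_cases hv : ∃ w, zWord w = v
    · obtain ⟨w, rfl⟩ := hv
      rw [coeff_ϖV_zWord]
      exact neg_one_pow_mul_self _ _
    · have hv' : ∀ w, zWord w ≠ v := fun w hw => hv ⟨w, hw⟩
      rw [coeff_ϖV_of_not _ _ hv', (mem_WHat_iff _).1 a.2 v hv']

variable (k G) in
/-- The algebra isomorphism `ϖ : k⟨⟨Y⟩⟩ ≃ Ŵ_G`, `y_{n,g} ↦ z_{n,g}`. -/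
noncomputable def ϖ : KY k G ≃ₐ[k] WHat k G := AlgEquiv.ofBijective (ϖHom k G) ϖHom_bijective

theorem ϖ_y (n : ℕ+) (g : G) : ϖ k G (y k n g) = z k n g := ϖHom_y n g

theorem isFiltered_ϖ : IsFiltered k (ϖ k G : KY k G →ₐ[k] WHat k G) := fun n f hf =>
  isFiltered_liftFree _ ϖ_mem n f hf

theorem isFiltered_ϖ_symm : IsFiltered k ((ϖ k G).symm : WHat k G →ₐ[k] KY k G) := by
  intro n a ha w hw
  have h1 : (ϖV k G ((ϖ k G).symm a)).coeff (zWord w) = (a : VHat k G).coeff (zWord w) :=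
    congrArg (fun a : WHat k G => (a : VHat k G).coeff (zWord w)) ((ϖ k G).apply_symm_apply a)
  rw [coeff_ϖV_zWord, show (a : VHat k G).coeff (zWord w) = 0 from
    ha _ (by rw [wt_zWord]; exact hw)] at h1
  have h2 : (-1 : k) ^ w.length * _ = (-1) ^ w.length * _ := congrArg ((-1) ^ w.length * ·) h1
  rw [neg_one_pow_mul_self, mul_zero] at h2
  exact h2

section harmonic

variable (k) {A : Type*} [Ring A] [Algebra k A] [FilteredAlgebra k A]

/-- For a family `c_{n,g}`, the element
`c_{n,g} ⊗ 1 + 1 ⊗ c_{n,g} + ∑_{0 < i < n} ∑_{h ∈ G} c_{i,h} ⊗ c_{n-i,gh⁻¹}`. -/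
noncomputable def harmonic (c : ℕ+ → G → A) (p : ℕ+ × G) : TensorSq k A :=
  tmul k (c p.1 p.2) 1 + tmul k 1 (c p.1 p.2) +
    ∑ i ∈ Finset.Iio p.1, ∑ h : G, tmul k (c i h) (c (p.1 - i) (p.2 * h⁻¹))

variable {k} in
theorem sum_mem_sqFil {ι : Type*} (s : Finset ι) (F : ι → TensorSq k A) {n N : ℕ}
    (h : ∀ i ∈ s, (F i).1 n ∈ sqFil k A n N) : (∑ i ∈ s, F i).1 n ∈ sqFil k A n N := by
  rw [AddSubmonoidClass.coe_finsetSum, Finset.sum_apply]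
  exact sum_mem h

theorem harmonic_mem (c : ℕ+ → G → A) (hc : ∀ (n : ℕ+) (g : G), c n g ∈ (fil k (n : ℕ) : Ideal A)) (p : ℕ+ × G)
    (n : ℕ) : (harmonic k c p).1 n ∈ sqFil k A n (deg p) := by
  have one_mem : (1 : A) ∈ (fil k 0 : Ideal A) := by rw [fil_zero]; trivial
  refine add_mem (add_mem (tmul_mem_sqFil (hc p.1 p.2) one_mem le_rfl)
    (tmul_mem_sqFil one_mem (hc p.1 p.2) (by rw [zero_add]; exact le_rfl))) ?_
  refine sum_mem_sqFil _ _ fun i hi => sum_mem_sqFil _ _ fun h _ =>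
    tmul_mem_sqFil (hc _ _) (hc _ _) ?_
  rw [← PNat.add_coe, PNat.add_sub_of_lt (Finset.mem_Iio.1 hi)]
  exact le_rfl

end harmonic

variable (k G) in
/-- The harmonic coproduct `Δ̂^alg_⋆` of `k⟨⟨Y⟩⟩`. -/
noncomputable def ΔAlg : KY k G →ₐ[k] TensorSq k (KY k G) :=
  liftSqFree (harmonic k (y k)) (harmonic_mem k (y k) y_mem)

variable (k G) in
/-- The continuous algebra morphism `k⟨⟨Y⟩⟩ → Ŵ_G ⊗̂ Ŵ_G` with
`y_{n,g} ↦ z_{n,g} ⊗ 1 + 1 ⊗ z_{n,g} + ∑_{0 < i < n} ∑_{h ∈ G} z_{i,h} ⊗ z_{n-i,gh⁻¹}`. -/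
noncomputable def ΔWFree : KY k G →ₐ[k] TensorSq k (WHat k G) :=
  liftSqFree (harmonic k (z k)) (harmonic_mem k (z k) z_mem)

variable (k G) in
/-- The inverse of `ϖ`. -/
noncomputable def ϖInv : WHat k G →ₐ[k] KY k G := (ϖ k G).symm

theorem ϖInv_z (n : ℕ+) (g : G) : ϖInv k G (z k n g) = y k n g :=
  (AlgEquiv.symm_apply_eq _).2 (ϖ_y n g).symm

variable (k G) in
/-- The coproduct `Δ̂^W_G` of `Ŵ_G`: the continuous algebra morphism with
`z_{n,g} ↦ z_{n,g} ⊗ 1 + 1 ⊗ z_{n,g} + ∑_{0 < i < n} ∑_{h ∈ G} z_{i,h} ⊗ z_{n-i,gh⁻¹}`. It exists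
since `Ŵ_G` is topologically free on the `z_{n,g}`. -/
noncomputable def ΔW : WHat k G →ₐ[k] TensorSq k (WHat k G) := (ΔWFree k G).comp (ϖInv k G)

theorem ΔAlg_y (n : ℕ+) (g : G) : ΔAlg k G (y k n g) = harmonic k (y k) (n, g) :=
  liftSqFree_letter _ (harmonic_mem k (y k) y_mem) (n, g)

theorem ΔW_z (n : ℕ+) (g : G) : ΔW k G (z k n g) = harmonic k (z k) (n, g) := by
  rw [ΔW, AlgHom.comp_apply, ϖInv_z]
  exact liftSqFree_letter _ (harmonic_mem k (z k) z_mem) (n, g)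

section action
variable [Algebra ℚ k]

/-- The automorphism `^Γaut^Y_Ψ = ϖ⁻¹ ∘ ^Γaut^{W,(1)}_Ψ ∘ ϖ` of `k⟨⟨Y⟩⟩`. -/
noncomputable def autY (Ψ : GrpLike k G) : KY k G →ₐ[k] KY k G :=
  ((ϖ k G).symm : WHat k G →ₐ[k] KY k G).comp ((autW Ψ).comp (ϖ k G : KY k G →ₐ[k] WHat k G))

theorem autY_apply (Ψ : GrpLike k G) (f : KY k G) :
    autY Ψ f = (ϖ k G).symm (autW Ψ (ϖ k G f)) := rfl

theorem isFiltered_autY (Ψ : GrpLike k G) : IsFiltered k (autY Ψ) :=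
  isFiltered_ϖ_symm.comp ((isFiltered_autW Ψ).comp isFiltered_ϖ)

theorem autW_mul_apply (Ψ Φ : GrpLike k G) (a : WHat k G) :
    autW (Ψ * Φ) a = autW Ψ (autW Φ a) := Subtype.ext (DFunLike.congr_fun (autΓ_mul Ψ Φ) a.1)
theorem autW_one_apply (a : WHat k G) :
    autW 1 a = a := Subtype.ext (DFunLike.congr_fun autΓ_one a.1)

variable (k G) in
/-- The action of `(𝒢(k⟨⟨X⟩⟩), ⊛)` on `k⟨⟨Y⟩⟩` by `Ψ ↦ ^Γaut^Y_Ψ`. -/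
noncomputable def actY : GrpLike k G →* FEnd k (KY k G) where
  toFun Ψ := ⟨autY Ψ, isFiltered_autY Ψ⟩
  map_one' := Subtype.ext (AlgHom.ext fun a => by
    change autY 1 a = a
    rw [autY_apply, autW_one_apply, AlgEquiv.symm_apply_apply])
  map_mul' Ψ Φ := Subtype.ext (AlgHom.ext fun a => by
    change autY (Ψ * Φ) a = autY Ψ (autY Φ a)
    rw [autY_apply, autY_apply, autY_apply, autW_mul_apply, AlgEquiv.apply_symm_apply])

variable (k G) in
/-- `Stab(Δ̂^W_G)(k)`, the group of `Ψ` with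
`(^Γaut^{W,(1)}_Ψ)^{⊗ 2} ∘ Δ̂^W_G = Δ̂^W_G ∘ ^Γaut^{W,(1)}_Ψ`. -/
noncomputable def stabW : Subgroup (GrpLike k G) := stab (actW k G) (ΔW k G)

variable (k G) in
/-- `Stab(Δ̂^alg_⋆)(k)`, the group of `Ψ` with
`(^Γaut^Y_Ψ)^{⊗ 2} ∘ Δ̂^alg_⋆ = Δ̂^alg_⋆ ∘ ^Γaut^Y_Ψ`. -/
noncomputable def stabAlg : Subgroup (GrpLike k G) := stab (actY k G) (ΔAlg k G)

end action

end

end DoubleShuffle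

/-! The proof is a transport of structure along `ϖ`. A group `H` that acts on a filtered algebra `A`
by filtered automorphisms `ρ(h)` acts on the algebra morphisms `D : A → A ⊗̂ A` by `h • D = ρ(h)^{⊗
2} ∘ D ∘ ρ(h)⁻¹`, and `stab ρ D` is the isotropy group of `D`, its condition being written without
the inverse. An isomorphism `e : A ≃ B` that is filtered in both directions gives a bijection `D ↦
e^{⊗ 2} ∘ D ∘ e⁻¹` from coproducts on `A` to coproducts on `B`. If `e` intertwines the actions on
`A` and `B`, this bijection is `H`-equivariant, so corresponding points have the same isotropy
group. It is the same subgroup of `H`, not merely a conjugate or an isomorphic one, because `H`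
itself is not altered. This is `stab_eq_of_equiv`.

Here `H` is the group of grouplike series under `⊛`, `A` is `k⟨⟨Y⟩⟩`, `B` is `Ŵ_G` and `e` is `ϖ`.
Three facts are needed.

Equivariance holds by construction: `autY Ψ` is defined as the conjugate of `autW Ψ` by `ϖ`. The
factor `Γ_Ψ` and the formulas for the automorphisms matter only for the two actions to exist.

The coproducts correspond because both are given on generators by the same universal expression,
`harmonic`, evaluated at the `y_{n,g}` on one side and at the `z_{n,g}` on the other. A filtered
morphism carries the expression for a family to the expression for the image family
(`mapSq_harmonic`), and `ϖ` sends `y_{n,g}` to `z_{n,g}`. The agreement on letters extends to all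
series by continuity (`ΔW_comp_ϖ`).

Finally, `ϖ^{⊗ 2}` has to be cancellable on the left. The completed tensor square is a limit of
squares of the truncations `A / Fⁿ A` and is functorial for filtered maps only, so bijectivity of
`ϖ` alone does not suffice: its inverse must be filtered too. This is `isFiltered_ϖ_symm`. It rests
on the fact that `ϖ` sends each word in the `y_{n,g}`, up to sign, to a monomial of the same weight,
with distinct words giving distinct monomials. -/

namespace DoubleShuffle

/-! ### Transport of stabilizers along an isomorphism of filtered algebras. -/

namespace FilteredAlgebra

variable {k : Type*} [CommRing k] {A B : Type*} [Ring A] [Algebra k A] [FilteredAlgebra k A]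
  [Ring B] [Algebra k B] [FilteredAlgebra k B]

/-- The completed tensor square of a morphism with a filtered retraction is injective. -/
theorem mapSq_injective {f : A →ₐ[k] B} (hf : IsFiltered k f) {g : B →ₐ[k] A}
    (hg : IsFiltered k g) (hgf : g.comp f = AlgHom.id k A) :
    Function.Injective (mapSq f hf) := by
  -- Injectivity of `f` would not be enough: it need not survive the passage to `A / Fⁿ A → B / Fⁿ
  -- B`, nor the tensor product over an arbitrary commutative ring. A filtered retraction does
  -- survive both, by functoriality, and yields a retraction of `f ⊗̂ f`.
  have h : (mapSq g hg).comp (mapSq f hf) = AlgHom.id k (TensorSq k A) := by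
    rw [← mapSq_comp, ← mapSq_id]
    -- Only the underlying morphisms have to be compared, and their equality is `hgf`. The
    -- filteredness proofs carried by `mapSq` are propositions, hence irrelevant.
    congr 1
  exact Function.LeftInverse.injective (g := mapSq g hg) fun t => DFunLike.congr_fun h t

/-- An isomorphism of filtered algebras that intertwines two actions and two coproducts identifies
the stabilizers of the coproducts. -/
theorem stab_eq_of_equiv {H : Type*} [Group H] (e : A ≃ₐ[k] B)
    (he : IsFiltered k (e : A →ₐ[k] B)) (he' : IsFiltered k (e.symm : B →ₐ[k] A))
    {ρ : H →* FEnd k A} {σ : H →* FEnd k B}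
    {D : A →ₐ[k] TensorSq k A} {E : B →ₐ[k] TensorSq k B}
    (hρ : ∀ h, (σ h : B →ₐ[k] B).comp (e : A →ₐ[k] B) = (e : A →ₐ[k] B).comp (ρ h : A →ₐ[k] A))
    (hD : E.comp (e : A →ₐ[k] B) = (mapSq (e : A →ₐ[k] B) he).comp D) :
    stab ρ D = stab σ E := by
  ext h
  -- This is the square of the intertwining relation `hρ`: each side is the completed tensor square
  -- of a composite, since `tensorSqMap` is `mapSq` on a filtered endomorphism and `mapSq` is
  -- functorial. Equivariance on the algebras thus becomes equivariance on their completed tensor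
  -- squares.
  have h1 : (tensorSqMap (σ h)).comp (mapSq (e : A →ₐ[k] B) he) =
      (mapSq (e : A →ₐ[k] B) he).comp (tensorSqMap (ρ h)) := by
    rw [tensorSqMap, tensorSqMap, ← mapSq_comp, ← mapSq_comp]
    congr 1
    exact hρ h
  -- The left-hand side of the stabilizer equation for `E`, precomposed with `e`, is the left-hand
  -- side of the equation for `D`, postcomposed with `e^{⊗ 2}`. Moving `e` from the source to the
  -- target crosses first `E`, by `hD`, and then `σ(h)^{⊗ 2}`, by `h1`.
  have h2 : ((tensorSqMap (σ h)).comp E).comp (e : A →ₐ[k] B) =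
      (mapSq (e : A →ₐ[k] B) he).comp ((tensorSqMap (ρ h)).comp D) := by
    rw [AlgHom.comp_assoc, hD, ← AlgHom.comp_assoc, h1, AlgHom.comp_assoc]
  -- The same transfer for the right-hand side crosses the two factors in the other order: first
  -- `σ(h)`, by `hρ`, and then `E`, by `hD`.
  have h3 : (E.comp (σ h : B →ₐ[k] B)).comp (e : A →ₐ[k] B) =
      (mapSq (e : A →ₐ[k] B) he).comp (D.comp (ρ h : A →ₐ[k] A)) := by
    rw [AlgHom.comp_assoc, hρ, ← AlgHom.comp_assoc, hD, AlgHom.comp_assoc]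
  -- The two membership conditions are linked by a chain of equivalences, so both inclusions are
  -- obtained at once. Prescribing `f` as `e` makes the rewriting apply to the equation between
  -- morphisms out of `B`, that is, the one for `E`. Surjectivity of `e` allows precomposition with
  -- `e` there without loss; `h2` and `h3` then turn both sides into composites beginning with
  -- morphisms out of `A` and ending with `e^{⊗ 2}`, which is cancelled on the left.
  rw [mem_stab, mem_stab, ← AlgHom.cancel_right e.surjective (f := (e : A →ₐ[k] B)), h2, h3,
    AlgHom.cancel_left]
  -- The left cancellation requires `e^{⊗ 2}` to be injective. The retraction is `e⁻¹`, and this is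
  -- where filteredness of the inverse, `he'`, enters.
  exact mapSq_injective he he' (AlgHom.ext e.symm_apply_apply)

end FilteredAlgebra

/-! ### Compatibility of `ϖ` with the two harmonic coproducts. -/

open FilteredAlgebra Series

variable {k : Type*} [CommRing k] {G : Type*} [CommGroup G] [Fintype G]

/-- The harmonic expression is natural in the algebra: it is a finite sum, all coefficients are one,
it is built only from pure tensors of members of the family and of the unit, and its index sets
depend on `n` and `G` alone. Linearity, preservation of the unit and `(f ⊗̂ f)(a ⊗ b) = f(a) ⊗ f(b)`
therefore suffice. Applied to `f = ϖ`, this identifies the values of the two coproducts on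
generators. -/
theorem mapSq_harmonic {A B : Type*} [Ring A] [Algebra k A] [FilteredAlgebra k A]
    [Ring B] [Algebra k B] [FilteredAlgebra k B] (f : A →ₐ[k] B) (hf : IsFiltered k f)
    (c : ℕ+ → G → A) (p : ℕ+ × G) :
    mapSq f hf (harmonic k c p) = harmonic k (fun n g => f (c n g)) p := by
  simp only [harmonic, map_add, map_sum, mapSq_tmul, map_one]

/-- Both composites are continuous morphisms out of the topologically free algebra `k⟨⟨Y⟩⟩`, so it
is enough to compare them on letters. There each gives the harmonic expression in the `z_{n,g}`: on
one side by the definition of the coproduct of `Ŵ_G` on `z_{n,g} = ϖ(y_{n,g})`, on the other by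
applying `ϖ^{⊗ 2}` to the harmonic expression in the `y_{n,g}`. Equivalently, `Δ̂^W_G` is `Δ̂^alg_⋆`
transported by `ϖ`. -/
theorem ΔW_comp_ϖ : (ΔW k G).comp (ϖ k G : KY k G →ₐ[k] WHat k G) =
    (mapSq (ϖ k G : KY k G →ₐ[k] WHat k G) isFiltered_ϖ).comp (ΔAlg k G) := by
  -- An algebra morphism on formal series is not determined by the letters unless it is continuous,
  -- so continuity of both sides has to be supplied. On the left, `ΔW` is by definition the lift
  -- from the free algebra precomposed with `ϖ⁻¹`, and a further precomposition with `ϖ` follows: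
  -- two filtered maps after which the lift is still continuous. On the right, the lift `ΔAlg` is
  -- followed by `ϖ^{⊗ 2}`, which acts level by level. The lifts themselves are continuous because
  -- their component at level `n` kills all series of weight at least `2n`: in a tensor of total
  -- weight `2n`, one of the two factors has weight at least `n` and vanishes in the truncation.
  refine freeSq_ext ((contSq_liftSqFree _ _).comp_filtered isFiltered_ϖ_symm |>.comp_filtered
    isFiltered_ϖ) ((contSq_liftSqFree _ _).mapSq_comp isFiltered_ϖ) fun p => ?_
  -- The letter with index the pair `p` is by definition `y_{n,g}` with `(n, g) = p`; in this form
  -- the evaluations of `ϖ` and of the coproducts on generators apply.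
  change ΔW k G (ϖ k G (y k p.1 p.2)) = mapSq _ isFiltered_ϖ (ΔAlg k G (y k p.1 p.2))
  rw [ϖ_y, ΔW_z, ΔAlg_y, mapSq_harmonic]
  -- Both sides are now the harmonic expression at the same index, for the family `z_{n,g}` and for
  -- the family `ϖ(y_{n,g})`. What remains is the equality of these families. It is needed for every
  -- `(n, g)`, since the expression at one index also involves the members of the family in all
  -- lower degrees.
  congr 1
  funext n g
  exact (ϖ_y n g).symm

end DoubleShuffle

/-! ### Equality of the two stabilizers. -/

theorem mainTheorem3 {k : Type*} [CommRing k] [Algebra ℚ k] {G : Type*} [CommGroup G] [Fintype G] :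
    DoubleShuffle.stabAlg k G = DoubleShuffle.stabW k G := by
  refine DoubleShuffle.FilteredAlgebra.stab_eq_of_equiv (DoubleShuffle.ϖ k G)
    DoubleShuffle.isFiltered_ϖ DoubleShuffle.isFiltered_ϖ_symm (fun Ψ => AlgHom.ext fun f => ?_)
    DoubleShuffle.ΔW_comp_ϖ
  -- Unfolding `autY Ψ = ϖ⁻¹ ∘ autW Ψ ∘ ϖ`, the relation `autW Ψ ∘ ϖ = ϖ ∘ autY Ψ` at a series `f`
  -- reads `a = ϖ(ϖ⁻¹(a))` with `a = autW Ψ (ϖ f)`.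
  exact ((DoubleShuffle.ϖ k G).apply_symm_apply _).symm
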